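/- Let $n\ge 0$ be an integer, let $a_1,\dots,a_n$ be real numbers, and let $\varepsilon_1,\dots,\varepsilon_n$ be independent random variables with $\mathbf P(\varepsilon_i=1)=\mathbf P(\varepsilon_i=-1)=\frac12$. Let $a_1^*\ge a_2^*\ge\dots\ge a_n^*$ be the nonincreasing rearrangement of $|a_1|,\dots,|a_n|$. For real $p\ge 2$ write $\|X\|_p=(\mathbf E|X|^p)^{1/p}$, and let $\gamma_p=\|g\|_p$, where $g$ is a standard Gaussian $\mathcal N(0,1)$ random variable. Then for every real $p\ge2$, $$ \max\bigg\{\gamma_p\bigg(\sum_{\lceil p/2\rceil\le i\le n}(a_i^*)^2\bigg)^{1/2},\ \frac1{\sqrt2}\sum_{1\le i\le n,\ i<\lceil p/2\rceil}a_i^*\bigg\} \le\bigg\|\sum_{i=1}^n a_i\varepsilon_i\bigg\|_p \le\gamma_p\bigg(\sum_{\lceil p/2\rceil\le i\le n}(a_i^*)^2\bigg)^{1/2}+\sum_{1\le i\le n,\ i<\lceil p/2\rceil}a_i^*, $$ where an empty sum is $0$. -/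

import Mathlib

open MeasureTheory ProbabilityTheory
open scoped ENNReal

/-- Independent symmetric random variables with values `±1` (up to null sets). -/
structure IsBernoulliFamily {Ω : Type*} [MeasurableSpace Ω] (μ : Measure Ω)
    {ι : Type*} (ε : ι → Ω → ℝ) : Prop where
  measurable : ∀ i, Measurable (ε i)
  prob_one : ∀ i, μ {ω | ε i ω = 1} = 1 / 2
  prob_neg_one : ∀ i, μ {ω | ε i ω = -1} = 1 / 2
  indep : iIndepFun ε μ

/-- The nonincreasing rearrangement of `(|a i|)`, indexed from `0`: the value at `i` is the
`(i + 1)`-st largest of the `|a j|`. (`Tuple.sort f` is a permutation making `f ∘ Tuple.sort f`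
monotone.) -/
noncomputable def nonincRearrangement {n : ℕ} (a : Fin n → ℝ) : Fin n → ℝ :=
  fun i => |a (Tuple.sort (fun j => -|a j|) i)|

theorem nonincRearrangement_antitone {n : ℕ} (a : Fin n → ℝ) :
    Antitone (nonincRearrangement a) := by
  intro i j hij
  have h := Tuple.monotone_sort (fun j => -|a j|) hij
  simpa [nonincRearrangement] using h

/-- `γ_p`, the `L^p` norm of a standard Gaussian random variable. -/
noncomputable def gaussianNorm (p : ℝ) : ℝ :=
  lpNorm (fun x : ℝ => x) (ENNReal.ofReal p) (gaussianReal 0 1)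

/-!
For `p ≥ 4`, both the Rademacher sum and a centred Gaussian satisfy an integration by parts formula.
On the Gaussian side it is the recurrence `E |g| ^ p = (p - 1) * E |g| ^ (p - 2)`; on the Rademacher
side convexity of `|x| ^ (p - 2)` turns it into an inequality between the `p`-th moment and the
`(p - 2)`-th moments of the sums with one term deleted. Each such step lowers `⌈p / 2⌉` by one and
deletes one coefficient, which reduces the Gaussian lower bound to `2 ≤ p < 4`. The other lower
bound holds because all signs in the head agree with those of the coefficients with probability
`2 ^ (-k)`, where `k ≤ p / 2` is the number of terms of the head, and adding the tail
does not decrease the moment.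

For `2 < p < 4`, `|x| ^ p` is a positive multiple of the integral of
`(cos (t * x) - 1 + t ^ 2 * x ^ 2 / 2) * t ^ (-p - 1)` over `t > 0`, so moments are compared through
the pointwise comparison of products of cosines with Gaussian exponentials.

For `p > 3`, the function `t ↦ |x + √t| ^ p + |x - √t| ^ p` is convex, so replacing the Rademacher
variables by Gaussian ones, one at a time, increases the moment; the head of the rearrangement is
removed by the triangle inequality. For `2 < p ≤ 3` this convexity fails and the head is the single
coefficient `b` of largest modulus. Let `τ ^ 2` be the variance of the remaining terms: the cosine
comparison gives the bound `γ_p * √(τ ^ 2 + 2 * b ^ 2)`, which suffices when `2 * b ≤ τ`, and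
otherwise the fourth moment does.
-/

open scoped NNReal

/-! ### Convexity -/

section

variable {f f' f'' : ℝ → ℝ}

theorem monotoneOn_add_comp_sub_of_convexOn (hf : ConvexOn ℝ Set.univ f) (x : ℝ) :
    MonotoneOn (fun u => f (x + u) + f (x - u)) (Set.Ici 0) := by
  intro u hu v hv huv
  rcases (show (0 : ℝ) ≤ v from hv).eq_or_lt with rfl | hv
  · rw [le_antisymm huv hu]
  have hl : 0 ≤ (v + u) / (2 * v) := div_nonneg (add_nonneg hv.le hu) (by linarith)
  have hl' : 0 ≤ (v - u) / (2 * v) := div_nonneg (sub_nonneg.2 huv) (by linarith)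
  have hsum : (v + u) / (2 * v) + (v - u) / (2 * v) = 1 := by field_simp; ring
  have hplus := hf.2 (Set.mem_univ (x + v)) (Set.mem_univ (x - v)) hl hl' hsum
  have hminus := hf.2 (Set.mem_univ (x + v)) (Set.mem_univ (x - v)) hl' hl
    ((add_comm _ _).trans hsum)
  have hplus_pt : ((v + u) / (2 * v)) • (x + v) + ((v - u) / (2 * v)) • (x - v) = x + u := by
    simp only [smul_eq_mul]; field_simp; ring
  have hminus_pt : ((v - u) / (2 * v)) • (x + v) + ((v + u) / (2 * v)) • (x - v) = x - u := by
    simp only [smul_eq_mul]; field_simp; ring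
  rw [hplus_pt] at hplus
  rw [hminus_pt] at hminus
  simp only [smul_eq_mul] at hplus hminus
  linear_combination hplus + hminus + (f (x + v) + f (x - v)) * hsum

theorem le_midpoint_of_convexOn (hf : ConvexOn ℝ Set.univ f) (x u : ℝ) :
    f x ≤ (f (x + u) + f (x - u)) / 2 := by
  have h := monotoneOn_add_comp_sub_of_convexOn hf x Set.self_mem_Ici (Set.mem_Ici.2 (abs_nonneg u))
    (abs_nonneg u)
  rcases abs_choice u with hu | hu <;> simp only [hu, add_zero, sub_zero, sub_neg_eq_add,
    ← sub_eq_add_neg] at h <;> linarith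

theorem hasDerivAt_sub_comp_sub (hf : ∀ x, HasDerivAt f (f' x) x) (x u : ℝ) :
    HasDerivAt (fun u => f (x + u) - f (x - u)) (f' (x + u) + f' (x - u)) u := by
  have hplus := (hf (x + u)).comp u ((hasDerivAt_id u).const_add x)
  have hminus := (hf (x - u)).comp u ((hasDerivAt_id u).const_sub x)
  exact (hplus.sub hminus).congr_deriv (by ring)

theorem convexOn_sub_comp_sub_of_hasDerivAt (hf : ∀ x, HasDerivAt f (f' x) x)
    (hf' : ConvexOn ℝ Set.univ f') (x : ℝ) :
    ConvexOn ℝ (Set.Ici 0) (fun u => f (x + u) - f (x - u)) := by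
  have hderiv := hasDerivAt_sub_comp_sub hf x
  refine MonotoneOn.convexOn_of_deriv (convex_Ici 0)
    (fun u _ => (hderiv u).continuousAt.continuousWithinAt)
    (fun u _ => (hderiv u).differentiableAt.differentiableWithinAt) ?_
  rw [funext fun u => (hderiv u).deriv]
  exact (monotoneOn_add_comp_sub_of_convexOn hf' x).mono interior_subset

theorem two_mul_sq_mul_deriv_le_of_convexOn (hf : ∀ x, HasDerivAt f (f' x) x)
    (hf' : ConvexOn ℝ Set.univ f') (x u : ℝ) :
    2 * u ^ 2 * f' x ≤ u * (f (x + u) - f (x - u)) := by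
  wlog hu : 0 ≤ u generalizing u
  · have h := this (-u) (by linarith)
    rw [← sub_eq_add_neg, sub_neg_eq_add] at h
    linear_combination h
  rcases hu.eq_or_lt with rfl | hu
  · simp
  have hslope := (convexOn_sub_comp_sub_of_hasDerivAt hf hf' x).le_slope_of_hasDerivAt
    Set.self_mem_Ici (Set.mem_Ici.2 hu.le) hu (hasDerivAt_sub_comp_sub hf x 0)
  rw [slope_def_field, le_div_iff₀ (by linarith)] at hslope
  simp only [add_zero, sub_zero, sub_self] at hslope
  nlinarith

theorem convexOn_comp_sqrt_of_hasDerivAt (hf : ∀ x, HasDerivAt f (f' x) x)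
    (hf' : ∀ x, HasDerivAt f' (f'' x) x) (hf'' : ConvexOn ℝ Set.univ f'') (x : ℝ) :
    ConvexOn ℝ (Set.Ici 0) (fun t => f (x + √t) + f (x - √t)) := by
  have hcont : Continuous f := continuous_iff_continuousAt.2 fun x => (hf x).continuousAt
  have hderiv : ∀ t ∈ Set.Ioi (0 : ℝ), HasDerivAt (fun t => f (x + √t) + f (x - √t))
      (slope (fun u => f' (x + u) - f' (x - u)) 0 (√t) / 2) t := by
    intro t ht
    have hsqrt := Real.hasDerivAt_sqrt (ne_of_gt ht)
    have hplus := (hf (x + √t)).comp t (hsqrt.const_add x)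
    have hminus := (hf (x - √t)).comp t (hsqrt.const_sub x)
    refine (hplus.add hminus).congr_deriv ?_
    have : 0 < √t := Real.sqrt_pos.2 ht
    rw [slope_def_field]
    simp only [add_zero, sub_zero, sub_self]
    field_simp
    ring
  refine MonotoneOn.convexOn_of_deriv (convex_Ici 0) (by fun_prop) ?_ ?_ <;> rw [interior_Ici]
  · exact fun t ht => (hderiv t ht).differentiableAt.differentiableWithinAt
  · intro s hs t ht hst
    rw [(hderiv s hs).deriv, (hderiv t ht).deriv]
    have hslope := (convexOn_sub_comp_sub_of_hasDerivAt hf' hf'' x).monotoneOn_slope_gt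
      Set.self_mem_Ici ⟨Real.sqrt_nonneg s, Real.sqrt_pos.2 hs⟩
      ⟨Real.sqrt_nonneg t, Real.sqrt_pos.2 ht⟩ (Real.sqrt_le_sqrt hst)
    linarith

theorem convexOn_abs_rpow {q : ℝ} (hq : 1 ≤ q) : ConvexOn ℝ Set.univ (fun x : ℝ => |x| ^ q) := by
  refine ⟨convex_univ, fun x _ y _ a b ha hb hab => ?_⟩
  have habs : |a • x + b • y| ≤ a • |x| + b • |y| := by
    refine (abs_add_le _ _).trans ?_
    simp [abs_mul, abs_of_nonneg ha, abs_of_nonneg hb]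
  exact (Real.rpow_le_rpow (abs_nonneg _) habs (by linarith)).trans
    ((convexOn_rpow hq).2 (abs_nonneg x) (abs_nonneg y) ha hb hab)

theorem hasDerivAt_abs_rpow_mul_self {q : ℝ} (hq : 1 < q) (x : ℝ) :
    HasDerivAt (fun x : ℝ => |x| ^ q * x) ((q + 1) * |x| ^ q) x := by
  refine ((hasDerivAt_abs_rpow x hq).mul (hasDerivAt_id x)).congr_deriv ?_
  have hpow : |x| ^ q = |x| ^ (q - 2) * x ^ 2 := by
    rcases eq_or_ne x 0 with rfl | hx
    · simp [Real.zero_rpow (by linarith : q ≠ 0)]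
    · rw [← sq_abs x, ← Real.rpow_two, ← Real.rpow_add (abs_pos.2 hx), sub_add_cancel]
  simp only [id, mul_one, hpow]
  ring

theorem convexOn_abs_rpow_comp_sqrt {p : ℝ} (hp : 3 < p) (x : ℝ) :
    ConvexOn ℝ (Set.Ici 0) (fun t => |x + √t| ^ p + |x - √t| ^ p) := by
  have hf (x : ℝ) : HasDerivAt (fun x => |x| ^ p) (p * (|x| ^ (p - 2) * x)) x := by
    simpa only [mul_assoc] using hasDerivAt_abs_rpow x (by linarith : 1 < p)
  have hf' (x : ℝ) : HasDerivAt (fun x => p * (|x| ^ (p - 2) * x))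
      (p * ((p - 2 + 1) * |x| ^ (p - 2))) x :=
    (hasDerivAt_abs_rpow_mul_self (by linarith) x).const_mul p
  refine convexOn_comp_sqrt_of_hasDerivAt hf hf' ?_ x
  exact ((convexOn_abs_rpow (by linarith)).smul (by linarith)).smul (by linarith)

end

/-! ### Bernoulli sums -/

/-- The Bernoulli sum `∑ i ∈ s, a i * ε i` as a random variable; the sums over all finite index sets
`s` are needed because the arguments add and delete single terms. -/
def bernoulliSum {Ω ι : Type*} (a : ι → ℝ) (ε : ι → Ω → ℝ) (s : Finset ι) : Ω → ℝ :=
  fun ω => ∑ i ∈ s, a i * ε i ω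

namespace IsBernoulliFamily

variable {Ω : Type*} [MeasurableSpace Ω] {μ : Measure Ω}
  {ι : Type*} {ε : ι → Ω → ℝ} {f : ℝ → ℝ} {i : ι} {s : Finset ι}

theorem measurable_bernoulliSum (hε : IsBernoulliFamily μ ε) (a : ι → ℝ) (s : Finset ι) :
    Measurable (bernoulliSum a ε s) :=
  Finset.measurable_fun_sum s fun i _ => (hε.measurable i).const_mul (a i)

theorem indepFun_bernoulliSum (hε : IsBernoulliFamily μ ε) (a : ι → ℝ) (hi : i ∉ s) :
    IndepFun (ε i) (bernoulliSum a ε s) μ := by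
  have heval : Measurable fun x : ({i} : Finset ι) → ℝ => x ⟨i, Finset.mem_singleton_self i⟩ :=
    measurable_pi_apply _
  have hlin : Measurable fun x : s → ℝ => ∑ j : s, a j * x j := by fun_prop
  have hindep := hε.indep.indepFun_finset {i} s (by simpa using hi) hε.measurable
  have hsum : bernoulliSum a ε s = fun ω => ∑ j : s, a j * ε j ω :=
    funext fun ω => (Finset.sum_coe_sort s fun j => a j * ε j ω).symm
  rw [hsum]
  exact hindep.comp heval hlin

variable [IsProbabilityMeasure μ]

theorem ae_eq_one_or_eq_neg_one (hε : IsBernoulliFamily μ ε) (i : ι) :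
    ∀ᵐ ω ∂μ, ε i ω = 1 ∨ ε i ω = -1 := by
  have hmeas (c : ℝ) : MeasurableSet {ω | ε i ω = c} := hε.measurable i (measurableSet_singleton c)
  have hdisj : Disjoint {ω | ε i ω = 1} {ω | ε i ω = -1} :=
    Set.disjoint_left.2 fun ω (h : ε i ω = 1) (h' : ε i ω = -1) => by linarith
  have hunion : μ ({ω | ε i ω = 1} ∪ {ω | ε i ω = -1}) = 1 := by
    rw [measure_union hdisj (hmeas _), hε.prob_one, hε.prob_neg_one]
    exact ENNReal.add_halves 1
  exact (prob_compl_eq_zero_iff ((hmeas _).union (hmeas _))).2 hunion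

theorem integral_eq_zero (hε : IsBernoulliFamily μ ε) (i : ι) : ∫ ω, ε i ω ∂μ = 0 := by
  have hmeas (c : ℝ) : MeasurableSet {ω | ε i ω = c} := hε.measurable i (measurableSet_singleton c)
  have hind : ε i =ᵐ[μ] fun ω => Set.indicator {ω | ε i ω = 1} (fun _ => (1 : ℝ)) ω
      - Set.indicator {ω | ε i ω = -1} (fun _ => (1 : ℝ)) ω := by
    filter_upwards [hε.ae_eq_one_or_eq_neg_one i] with ω h
    rcases h with h | h <;> simp [h, Set.indicator] <;> norm_num
  rw [integral_congr_ae hind, integral_sub ((integrable_const _).indicator (hmeas _))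
    ((integrable_const _).indicator (hmeas _)), integral_indicator (hmeas _),
    integral_indicator (hmeas _)]
  simp [Measure.real, hε.prob_one, hε.prob_neg_one]

theorem ae_abs_bernoulliSum_le (hε : IsBernoulliFamily μ ε) (a : ι → ℝ) (s : Finset ι) :
    ∀ᵐ ω ∂μ, |bernoulliSum a ε s ω| ≤ ∑ i ∈ s, |a i| := by
  have hsign : ∀ᵐ ω ∂μ, ∀ i ∈ s, ε i ω = 1 ∨ ε i ω = -1 :=
    (ae_ball_iff s.countable_toSet).2 fun i _ => hε.ae_eq_one_or_eq_neg_one i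
  filter_upwards [hsign] with ω h
  refine (Finset.abs_sum_le_sum_abs _ _).trans (Finset.sum_le_sum fun i hi => ?_)
  rcases h i hi with h | h <;> simp [h]

theorem memLp_bernoulliSum (hε : IsBernoulliFamily μ ε) (a : ι → ℝ) (s : Finset ι) (q : ℝ≥0∞) :
    MemLp (bernoulliSum a ε s) q μ :=
  MemLp.of_bound (hε.measurable_bernoulliSum a s).aestronglyMeasurable _
    (hε.ae_abs_bernoulliSum_le a s)

theorem integrable_comp_bernoulliSum (hε : IsBernoulliFamily μ ε) (a : ι → ℝ) (s : Finset ι)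
    (hf : Continuous f) : Integrable (fun ω => f (bernoulliSum a ε s ω)) μ := by
  obtain ⟨C, hC⟩ := (isCompact_Icc (a := -∑ i ∈ s, |a i|)
    (b := ∑ i ∈ s, |a i|)).exists_bound_of_continuousOn hf.continuousOn
  refine Integrable.of_bound
    (hf.measurable.comp (hε.measurable_bernoulliSum a s)).aestronglyMeasurable C ?_
  filter_upwards [hε.ae_abs_bernoulliSum_le a s] with ω h
  exact hC _ (abs_le.1 h)

theorem integrable_mul_comp_bernoulliSum (hε : IsBernoulliFamily μ ε) (a : ι → ℝ) (i : ι)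
    (s : Finset ι) (hf : Continuous f) :
    Integrable (fun ω => ε i ω * f (bernoulliSum a ε s ω)) μ := by
  refine (hε.integrable_comp_bernoulliSum a s hf).bdd_mul (c := 1)
    (hε.measurable i).aestronglyMeasurable ?_
  filter_upwards [hε.ae_eq_one_or_eq_neg_one i] with ω h
  rcases h with h | h <;> simp [h]

theorem integral_mul_comp_bernoulliSum_eq_zero (hε : IsBernoulliFamily μ ε) (a : ι → ℝ)
    (hi : i ∉ s) (hf : Continuous f) : ∫ ω, ε i ω * f (bernoulliSum a ε s ω) ∂μ = 0 := by
  have hindep : IndepFun (ε i) (fun ω => f (bernoulliSum a ε s ω)) μ :=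
    (hε.indepFun_bernoulliSum a hi).comp measurable_id hf.measurable
  rw [hindep.integral_fun_mul_eq_mul_integral (hε.measurable i).aestronglyMeasurable
    (hε.integrable_comp_bernoulliSum a s hf).1, hε.integral_eq_zero, zero_mul]

theorem integral_comp_insert [DecidableEq ι] (hε : IsBernoulliFamily μ ε) (a : ι → ℝ)
    (hi : i ∉ s) (hf : Continuous f) :
    ∫ ω, f (bernoulliSum a ε (insert i s) ω) ∂μ
      = ∫ ω, (f (bernoulliSum a ε s ω + a i) + f (bernoulliSum a ε s ω - a i)) / 2 ∂μ := by
  have heven : Continuous fun x => (f (x + a i) + f (x - a i)) / 2 := by fun_prop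
  have hodd : Continuous fun x => (f (x + a i) - f (x - a i)) / 2 := by fun_prop
  have hsplit : (fun ω => f (bernoulliSum a ε (insert i s) ω)) =ᵐ[μ] fun ω =>
      (f (bernoulliSum a ε s ω + a i) + f (bernoulliSum a ε s ω - a i)) / 2
        + ε i ω * ((f (bernoulliSum a ε s ω + a i) - f (bernoulliSum a ε s ω - a i)) / 2) := by
    filter_upwards [hε.ae_eq_one_or_eq_neg_one i] with ω h
    simp only [bernoulliSum, Finset.sum_insert hi]
    rcases h with h | h <;> rw [h] <;> ring_nf
  rw [integral_congr_ae hsplit, integral_add (hε.integrable_comp_bernoulliSum a s heven)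
    (hε.integrable_mul_comp_bernoulliSum a i s hodd),
    hε.integral_mul_comp_bernoulliSum_eq_zero a hi hodd, add_zero]

theorem integral_mul_comp_insert [DecidableEq ι] (hε : IsBernoulliFamily μ ε) (a : ι → ℝ)
    (hi : i ∉ s) (hf : Continuous f) :
    ∫ ω, ε i ω * f (bernoulliSum a ε (insert i s) ω) ∂μ
      = ∫ ω, (f (bernoulliSum a ε s ω + a i) - f (bernoulliSum a ε s ω - a i)) / 2 ∂μ := by
  have heven : Continuous fun x => (f (x + a i) + f (x - a i)) / 2 := by fun_prop
  have hodd : Continuous fun x => (f (x + a i) - f (x - a i)) / 2 := by fun_prop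
  have hsplit : (fun ω => ε i ω * f (bernoulliSum a ε (insert i s) ω)) =ᵐ[μ] fun ω =>
      (f (bernoulliSum a ε s ω + a i) - f (bernoulliSum a ε s ω - a i)) / 2
        + ε i ω * ((f (bernoulliSum a ε s ω + a i) + f (bernoulliSum a ε s ω - a i)) / 2) := by
    filter_upwards [hε.ae_eq_one_or_eq_neg_one i] with ω h
    simp only [bernoulliSum, Finset.sum_insert hi]
    rcases h with h | h <;> rw [h] <;> ring_nf
  rw [integral_congr_ae hsplit, integral_add (hε.integrable_comp_bernoulliSum a s hodd)
    (hε.integrable_mul_comp_bernoulliSum a i s heven),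
    hε.integral_mul_comp_bernoulliSum_eq_zero a hi heven, add_zero]

theorem integral_bernoulliSum_mul_comp [DecidableEq ι] (hε : IsBernoulliFamily μ ε) (a : ι → ℝ)
    (s : Finset ι) (hf : Continuous f) :
    ∫ ω, bernoulliSum a ε s ω * f (bernoulliSum a ε s ω) ∂μ
      = ∑ i ∈ s, a i * ∫ ω, (f (bernoulliSum a ε (s.erase i) ω + a i)
          - f (bernoulliSum a ε (s.erase i) ω - a i)) / 2 ∂μ := by
  have hexpand (ω : Ω) : bernoulliSum a ε s ω * f (bernoulliSum a ε s ω)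
      = ∑ i ∈ s, a i * (ε i ω * f (bernoulliSum a ε s ω)) := by
    simp only [← mul_assoc, ← Finset.sum_mul, bernoulliSum]
  simp only [hexpand]
  rw [integral_finsetSum _ fun i _ =>
    (hε.integrable_mul_comp_bernoulliSum a i s hf).const_mul (a i)]
  refine Finset.sum_congr rfl fun i hi => ?_
  rw [integral_const_mul, ← hε.integral_mul_comp_insert a (Finset.notMem_erase i s) hf,
    Finset.insert_erase hi]

theorem integral_sq (hε : IsBernoulliFamily μ ε) (a : ι → ℝ) (s : Finset ι) :
    ∫ ω, bernoulliSum a ε s ω ^ 2 ∂μ = ∑ i ∈ s, a i ^ 2 := by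
  classical
  simpa [pow_two] using hε.integral_bernoulliSum_mul_comp a s continuous_id

theorem integral_pow_four_insert [DecidableEq ι] (hε : IsBernoulliFamily μ ε) (a : ι → ℝ)
    (hi : i ∉ s) :
    ∫ ω, bernoulliSum a ε (insert i s) ω ^ 4 ∂μ
      = ∫ ω, bernoulliSum a ε s ω ^ 4 ∂μ + 6 * a i ^ 2 * ∑ j ∈ s, a j ^ 2 + a i ^ 4 := by
  have hexpand (x : ℝ) : ((x + a i) ^ 4 + (x - a i) ^ 4) / 2
      = x ^ 4 + 6 * a i ^ 2 * x ^ 2 + a i ^ 4 := by ring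
  rw [hε.integral_comp_insert a hi (f := fun x => x ^ 4) (by fun_prop)]
  simp only [hexpand]
  have hfour := hε.integrable_comp_bernoulliSum a s (continuous_pow 4)
  have htwo := (hε.integrable_comp_bernoulliSum a s (continuous_pow 2)).const_mul (6 * a i ^ 2)
  rw [integral_add (hfour.fun_add htwo) (integrable_const _), integral_add hfour htwo,
    integral_const_mul, hε.integral_sq, integral_const, probReal_univ, one_smul]

theorem integral_pow_four_le (hε : IsBernoulliFamily μ ε) (a : ι → ℝ) (s : Finset ι) :
    ∫ ω, bernoulliSum a ε s ω ^ 4 ∂μ ≤ 3 * (∑ i ∈ s, a i ^ 2) ^ 2 := by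
  classical
  induction s using Finset.induction_on with
  | empty => simp [bernoulliSum]
  | insert i s hi ih =>
    rw [hε.integral_pow_four_insert a hi, Finset.sum_insert hi]
    nlinarith [sq_nonneg (a i ^ 2)]

theorem integral_cos_mul (hε : IsBernoulliFamily μ ε) (a : ι → ℝ) (s : Finset ι) (t : ℝ) :
    ∫ ω, Real.cos (t * bernoulliSum a ε s ω) ∂μ = ∏ i ∈ s, Real.cos (t * a i) := by
  classical
  induction s using Finset.induction_on with
  | empty => simp [bernoulliSum]
  | insert i s hi ih =>
    have hexpand (x : ℝ) : (Real.cos (t * (x + a i)) + Real.cos (t * (x - a i))) / 2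
        = Real.cos (t * a i) * Real.cos (t * x) := by
      rw [mul_add, mul_sub, Real.cos_add, Real.cos_sub]; ring
    rw [hε.integral_comp_insert a hi (f := fun x => Real.cos (t * x)) (by fun_prop),
      Finset.prod_insert hi, ← ih, ← integral_const_mul]
    simp only [hexpand]

theorem monotone_integral_comp (hε : IsBernoulliFamily μ ε) (a : ι → ℝ)
    (hf : ConvexOn ℝ Set.univ f) : Monotone fun s => ∫ ω, f (bernoulliSum a ε s ω) ∂μ := by
  classical
  have hcont : Continuous f := continuousOn_univ.1 (hf.continuousOn isOpen_univ)
  refine Finset.monotone_iff_forall_le_insert.2 fun s i hi => ?_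
  rw [hε.integral_comp_insert a hi hcont]
  exact integral_mono (hε.integrable_comp_bernoulliSum a s hcont)
    (hε.integrable_comp_bernoulliSum a s (f := fun x => (f (x + a i) + f (x - a i)) / 2)
      (by fun_prop)) fun ω => le_midpoint_of_convexOn hf _ _

theorem div_two_pow_card_le_integral_comp (hε : IsBernoulliFamily μ ε) (a : ι → ℝ) (s : Finset ι)
    (hf : Continuous f) (h0 : ∀ x, 0 ≤ f x) :
    f (∑ i ∈ s, |a i|) / 2 ^ s.card ≤ ∫ ω, f (bernoulliSum a ε s ω) ∂μ := by
  classical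
  induction s using Finset.induction_on generalizing f with
  | empty => simp [bernoulliSum]
  | insert i s hi ih =>
    rw [hε.integral_comp_insert a hi hf, Finset.sum_insert hi, Finset.card_insert_of_notMem hi]
    calc f (|a i| + ∑ j ∈ s, |a j|) / 2 ^ (s.card + 1)
        = f (∑ j ∈ s, |a j| + |a i|) / 2 / 2 ^ s.card := by
          rw [pow_succ', div_div, add_comm]
      _ ≤ ∫ ω, f (bernoulliSum a ε s ω + |a i|) / 2 ∂μ :=
          ih (f := fun x => f (x + |a i|) / 2) (by fun_prop) fun x => div_nonneg (h0 _) two_pos.le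
      _ ≤ _ := by
          refine integral_mono (hε.integrable_comp_bernoulliSum a s
            (f := fun x => f (x + |a i|) / 2) (by fun_prop)) (hε.integrable_comp_bernoulliSum a s
            (f := fun x => (f (x + a i) + f (x - a i)) / 2) (by fun_prop)) fun ω => ?_
          have hplus := h0 (bernoulliSum a ε s ω + a i)
          have hminus := h0 (bernoulliSum a ε s ω - a i)
          rcases abs_choice (a i) with h | h <;> simp only [h, ← sub_eq_add_neg] <;> linarith

end IsBernoulliFamily

/-! ### `L^p` norms -/

section

variable {Ω Ω' : Type*} [MeasurableSpace Ω] [MeasurableSpace Ω'] {μ : Measure Ω} {ν : Measure Ω'}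
  {X : Ω → ℝ} {Y : Ω' → ℝ}

theorem lpNorm_rpow_eq_integral_abs_rpow (hX : AEStronglyMeasurable X μ) {p : ℝ} (hp : 0 < p) :
    lpNorm X (ENNReal.ofReal p) μ ^ p = ∫ ω, |X ω| ^ p ∂μ := by
  rw [lpNorm_eq_integral_norm_rpow_toReal (by simpa using hp) ENNReal.ofReal_ne_top hX,
    ENNReal.toReal_ofReal hp.le, Real.rpow_inv_rpow (integral_nonneg fun _ => by positivity) hp.ne']
  rfl

theorem lpNorm_le_lpNorm_of_integral_abs_rpow_le (hX : AEStronglyMeasurable X μ)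
    (hY : AEStronglyMeasurable Y ν) {p : ℝ} (hp : 0 < p)
    (h : ∫ ω, |X ω| ^ p ∂μ ≤ ∫ ω, |Y ω| ^ p ∂ν) :
    lpNorm X (ENNReal.ofReal p) μ ≤ lpNorm Y (ENNReal.ofReal p) ν := by
  rwa [← Real.rpow_le_rpow_iff lpNorm_nonneg lpNorm_nonneg hp,
    lpNorm_rpow_eq_integral_abs_rpow hX hp, lpNorm_rpow_eq_integral_abs_rpow hY hp]

variable [IsProbabilityMeasure μ]

theorem lpNorm_le_lpNorm_of_exponent_le {p q : ℝ≥0∞} (hpq : p ≤ q) (hX : MemLp X q μ) :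
    lpNorm X p μ ≤ lpNorm X q μ := by
  rw [← toReal_eLpNorm hX.1, ← toReal_eLpNorm hX.1]
  exact ENNReal.toReal_mono hX.eLpNorm_ne_top (eLpNorm_le_eLpNorm_of_exponent_le hpq hX.1)

theorem lpNorm_le_of_ae_abs_le {p : ℝ≥0∞} {C : ℝ} (hX : AEStronglyMeasurable X μ) (hC : 0 ≤ C)
    (h : ∀ᵐ ω ∂μ, |X ω| ≤ C) : lpNorm X p μ ≤ C := by
  rw [← toReal_eLpNorm hX]
  exact ENNReal.toReal_le_of_le_ofReal hC ((eLpNorm_le_of_ae_bound h).trans (by simp))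

end

/-! ### Gaussian moments -/

section

variable {p : ℝ}

theorem lpNorm_id_gaussianReal (p : ℝ) (v : ℝ≥0) :
    lpNorm (fun x : ℝ => x) (ENNReal.ofReal p) (gaussianReal 0 v) = gaussianNorm p * √v := by
  have hmap : (gaussianReal 0 1).map (√v * ·) = gaussianReal 0 v := by
    rw [gaussianReal_map_const_mul, mul_zero]
    congr 1
    ext
    simp
  rw [← hmap, ← toReal_eLpNorm (by fun_prop), eLpNorm_map_measure (by fun_prop) (by fun_prop),
    toReal_eLpNorm (by fun_prop)]
  exact (lpNorm_const_smul √v (fun x : ℝ => x) (gaussianReal 0 1)).trans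
    (by simp [gaussianNorm, mul_comm])

theorem integrable_abs_rpow_gaussianReal (hp : 0 < p) (m : ℝ) (v : ℝ≥0) :
    Integrable (fun y => |y| ^ p) (gaussianReal m v) := by
  have h := (memLp_id_gaussianReal' (μ := m) (v := v) (ENNReal.ofReal p)
    ENNReal.ofReal_ne_top).integrable_norm_rpow (by simpa using hp) ENNReal.ofReal_ne_top
  simpa [ENNReal.toReal_ofReal hp.le] using h

theorem integral_abs_rpow_gaussianReal_eq_Gamma {v : ℝ≥0} (hv : v ≠ 0) (hp : -1 < p) :
    ∫ y, |y| ^ p ∂gaussianReal 0 v = (√(2 * Real.pi * v))⁻¹ *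
      (2 * ((2 * v : ℝ)⁻¹ ^ (-(p + 1) / 2) * (1 / 2) * Real.Gamma ((p + 1) / 2))) := by
  have : (0 : ℝ) < v := by positivity
  rw [integral_gaussianReal_eq_integral_smul hv,
    ← integral_rpow_mul_exp_neg_mul_rpow two_pos hp (inv_pos.2 (by positivity)),
    ← integral_comp_abs (f := fun x : ℝ => x ^ p * Real.exp (-(2 * v : ℝ)⁻¹ * x ^ (2 : ℝ))),
    ← integral_const_mul]
  congr 1 with x
  rw [gaussianPDFReal, smul_eq_mul, Real.rpow_two, sq_abs,
    show -(x - 0) ^ 2 / (2 * v) = -(2 * v : ℝ)⁻¹ * x ^ 2 by ring]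
  ring

theorem integral_abs_rpow_gaussianReal_eq_mul (hp : 1 < p) (v : ℝ≥0) :
    ∫ y, |y| ^ p ∂gaussianReal 0 v = (p - 1) * v * ∫ y, |y| ^ (p - 2) ∂gaussianReal 0 v := by
  rcases eq_or_ne v 0 with rfl | hv
  · simp [Real.zero_rpow (by linarith : p ≠ 0)]
  have : (0 : ℝ) < v := by positivity
  rw [integral_abs_rpow_gaussianReal_eq_Gamma hv (by linarith),
    integral_abs_rpow_gaussianReal_eq_Gamma hv (by linarith),
    show (p + 1) / 2 = (p - 1) / 2 + 1 by ring, show (p - 2 + 1) / 2 = (p - 1) / 2 by ring,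
    show -(p + 1) / 2 = -(p - 2 + 1) / 2 + (-1) by ring, Real.Gamma_add_one (by linarith),
    Real.rpow_add (by positivity), Real.rpow_neg_one, inv_inv]
  ring

theorem integral_sq_gaussianReal (v : ℝ≥0) : ∫ y, y ^ 2 ∂gaussianReal 0 v = v := by
  have h := integral_abs_rpow_gaussianReal_eq_mul one_lt_two v
  norm_num at h
  exact h

theorem integral_cos_mul_gaussianReal (v : ℝ≥0) (t : ℝ) :
    ∫ y, Real.cos (t * y) ∂gaussianReal 0 v = Real.exp (-(t ^ 2 * v) / 2) := by
  have hint : Integrable (fun y : ℝ => Complex.exp (t * y * Complex.I)) (gaussianReal 0 v) := by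
    refine Integrable.of_bound (by fun_prop) 1 (Filter.Eventually.of_forall fun y => ?_)
    rw [← Complex.ofReal_mul, Complex.norm_exp_ofReal_mul_I]
  have hre := Complex.reCLM.integral_comp_comm hint
  rw [← charFun_apply_real, charFun_gaussianReal] at hre
  simp only [Complex.reCLM_apply, ← Complex.ofReal_mul, Complex.exp_ofReal_mul_I_re] at hre
  rw [hre, ← Complex.exp_ofReal_re]
  congr 2
  push_cast
  ring

theorem gaussianNorm_nonneg (p : ℝ) : 0 ≤ gaussianNorm p := lpNorm_nonneg

theorem gaussianNorm_rpow (hp : 0 < p) : gaussianNorm p ^ p = ∫ y, |y| ^ p ∂gaussianReal 0 1 :=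
  lpNorm_rpow_eq_integral_abs_rpow (by fun_prop) hp

theorem gaussianNorm_two : gaussianNorm 2 = 1 := by
  have h := gaussianNorm_rpow two_pos
  simp only [Real.rpow_two, sq_abs, integral_sq_gaussianReal, NNReal.coe_one] at h
  exact (pow_eq_one_iff_of_nonneg (gaussianNorm_nonneg 2) two_ne_zero).1 h

theorem gaussianNorm_four_pow_four : gaussianNorm 4 ^ 4 = 3 := by
  have h := gaussianNorm_rpow four_pos
  rw [integral_abs_rpow_gaussianReal_eq_mul (by norm_num)] at h
  norm_num [integral_sq_gaussianReal] at h
  exact_mod_cast h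

theorem gaussianNorm_mono : Monotone gaussianNorm := fun _ _ hpq =>
  lpNorm_le_lpNorm_of_exponent_le (ENNReal.ofReal_le_ofReal hpq)
    (memLp_id_gaussianReal' _ ENNReal.ofReal_ne_top)

theorem one_le_gaussianNorm (hp : 2 ≤ p) : 1 ≤ gaussianNorm p :=
  gaussianNorm_two ▸ gaussianNorm_mono hp

theorem gaussianNorm_le_two (hp : p ≤ 4) : gaussianNorm p ≤ 2 := by
  refine (gaussianNorm_mono hp).trans (le_of_pow_le_pow_left₀ four_ne_zero zero_le_two ?_)
  rw [gaussianNorm_four_pow_four]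
  norm_num

end

/-! ### Lindeberg's exchange -/

section

variable {f : ℝ → ℝ}

theorem integrable_comp_const_add_gaussianReal (hf : Continuous f)
    (hint : ∀ m v, Integrable f (gaussianReal m v)) (x m : ℝ) (v : ℝ≥0) :
    Integrable (fun z => f (x + z)) (gaussianReal m v) := by
  have h := hint (m + x) v
  rwa [← gaussianReal_map_const_add, integrable_map_measure hf.aestronglyMeasurable
    (by fun_prop)] at h

theorem integrable_comp_const_sub_gaussianReal (hf : Continuous f)
    (hint : ∀ m v, Integrable f (gaussianReal m v)) (x m : ℝ) (v : ℝ≥0) :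
    Integrable (fun z => f (x - z)) (gaussianReal m v) := by
  have h := hint (x - m) v
  rwa [← gaussianReal_map_const_sub, integrable_map_measure hf.aestronglyMeasurable
    (by fun_prop)] at h

theorem integral_comp_const_add_gaussianReal (hf : Continuous f) (x m : ℝ) (v : ℝ≥0) :
    ∫ z, f (x + z) ∂gaussianReal m v = ∫ y, f y ∂gaussianReal (m + x) v := by
  rw [← gaussianReal_map_const_add, integral_map (by fun_prop) hf.aestronglyMeasurable]

theorem integral_comp_const_sub_gaussianReal (hf : Continuous f) (x m : ℝ) (v : ℝ≥0) :
    ∫ z, f (x - z) ∂gaussianReal m v = ∫ y, f y ∂gaussianReal (x - m) v := by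
  rw [← gaussianReal_map_const_sub, integral_map (by fun_prop) hf.aestronglyMeasurable]

theorem midpoint_le_integral_gaussianReal_of_convexOn (hf : Continuous f) {x : ℝ}
    (hconv : ConvexOn ℝ (Set.Ici 0) fun t => f (x + √t) + f (x - √t))
    (hint : ∀ m v, Integrable f (gaussianReal m v)) (a : ℝ) :
    (f (x + a) + f (x - a)) / 2 ≤ ∫ y, f y ∂gaussianReal x (‖a‖₊ ^ 2) := by
  have hsqrt (z : ℝ) : f (x + √(z ^ 2)) + f (x - √(z ^ 2)) = f (x + z) + f (x - z) := by
    rw [Real.sqrt_sq_eq_abs]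
    rcases abs_choice z with h | h <;> simp [h, ← sub_eq_add_neg, add_comm]
  -- Jensen's inequality is applied in the variable `t = z ^ 2`, whose mean is `a ^ 2`.
  have hadd := integrable_comp_const_add_gaussianReal hf hint x 0 (‖a‖₊ ^ 2)
  have hsub := integrable_comp_const_sub_gaussianReal hf hint x 0 (‖a‖₊ ^ 2)
  have jensen := hconv.map_integral_le (μ := gaussianReal 0 (‖a‖₊ ^ 2)) (f := fun z => z ^ 2)
    (Continuous.continuousOn (by fun_prop)) isClosed_Ici
    (Filter.Eventually.of_forall fun z => Set.mem_Ici.2 (sq_nonneg z))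
    (memLp_id_gaussianReal' (μ := 0) (v := ‖a‖₊ ^ 2) 2 (by simp)).integrable_sq
    (by simp only [Function.comp_def, hsqrt]; exact hadd.add hsub)
  simp only [hsqrt, integral_sq_gaussianReal, NNReal.coe_pow, coe_nnnorm, Real.norm_eq_abs,
    sq_abs] at jensen
  rw [integral_add hadd hsub, integral_comp_const_add_gaussianReal hf,
    integral_comp_const_sub_gaussianReal hf, zero_add, sub_zero] at jensen
  linarith

variable (hf : Continuous f) (hconv : ∀ x, ConvexOn ℝ (Set.Ici 0) fun t => f (x + √t) + f (x - √t))
  (hint : ∀ m v, Integrable f (gaussianReal m v))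

include hf hconv hint

theorem midpoint_integral_gaussianReal_le (x a : ℝ) (v : ℝ≥0) :
    (∫ y, f y ∂gaussianReal (x + a) v + ∫ y, f y ∂gaussianReal (x - a) v) / 2
      ≤ ∫ y, f y ∂gaussianReal x (v + ‖a‖₊ ^ 2) := by
  have hmid (z : ℝ) : (f (a + z) + f (-a + z)) / 2 ≤ ∫ y, f (z + y) ∂gaussianReal 0 (‖a‖₊ ^ 2) := by
    rw [integral_comp_const_add_gaussianReal hf, zero_add, add_comm a, neg_add_eq_sub]
    exact midpoint_le_integral_gaussianReal_of_convexOn hf (hconv z) hint a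
  have hsum : gaussianReal x v ∗ gaussianReal 0 (‖a‖₊ ^ 2) = gaussianReal x (v + ‖a‖₊ ^ 2) := by
    rw [gaussianReal_conv_gaussianReal, add_zero]
  have hadd := integrable_comp_const_add_gaussianReal hf hint a x v
  have hsub := integrable_comp_const_add_gaussianReal hf hint (-a) x v
  have hconvint : Integrable f (gaussianReal x v ∗ gaussianReal 0 (‖a‖₊ ^ 2)) := hsum ▸ hint _ _
  have hinner :
      Integrable (fun z => ∫ y, f (z + y) ∂gaussianReal 0 (‖a‖₊ ^ 2)) (gaussianReal x v) :=
    ((integrable_map_measure hf.aestronglyMeasurable (by fun_prop)).1 hconvint).integral_prod_left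
  rw [← hsum, integral_conv hconvint, sub_eq_add_neg, ← integral_comp_const_add_gaussianReal hf,
    ← integral_comp_const_add_gaussianReal hf, ← integral_add hadd hsub, ← integral_div]
  exact integral_mono ((hadd.add hsub).div_const 2) hinner hmid

theorem IsBernoulliFamily.integral_const_add_bernoulliSum_le_integral_gaussianReal
    {Ω ι : Type*} [MeasurableSpace Ω] {μ : Measure Ω} [IsProbabilityMeasure μ] {ε : ι → Ω → ℝ}
    (hε : IsBernoulliFamily μ ε) (a : ι → ℝ) (s : Finset ι) (x : ℝ) :
    ∫ ω, f (x + bernoulliSum a ε s ω) ∂μ ≤ ∫ y, f y ∂gaussianReal x (∑ i ∈ s, ‖a i‖₊ ^ 2) := by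
  classical
  induction s using Finset.induction_on generalizing x with
  | empty => simp [bernoulliSum, gaussianReal_zero_var]
  | insert i s hi ih =>
    have hint_shift (c : ℝ) : Integrable (fun ω => f (c + bernoulliSum a ε s ω)) μ :=
      hε.integrable_comp_bernoulliSum a s (hf.comp (continuous_const_add c))
    calc ∫ ω, f (x + bernoulliSum a ε (insert i s) ω) ∂μ
      _ = (∫ ω, f (x + a i + bernoulliSum a ε s ω) ∂μ
          + ∫ ω, f (x - a i + bernoulliSum a ε s ω) ∂μ) / 2 := by
        rw [hε.integral_comp_insert a hi (f := fun y => f (x + y)) (by fun_prop),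
          ← integral_add (hint_shift _) (hint_shift _), ← integral_div]
        congr with ω
        ring_nf
      _ ≤ (∫ y, f y ∂gaussianReal (x + a i) (∑ j ∈ s, ‖a j‖₊ ^ 2)
          + ∫ y, f y ∂gaussianReal (x - a i) (∑ j ∈ s, ‖a j‖₊ ^ 2)) / 2 := by
        gcongr <;> exact ih _
      _ ≤ ∫ y, f y ∂gaussianReal x (∑ j ∈ insert i s, ‖a j‖₊ ^ 2) := by
        rw [Finset.sum_insert hi, add_comm (‖a i‖₊ ^ 2)]
        exact midpoint_integral_gaussianReal_le hf hconv hint x (a i) _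

end

theorem IsBernoulliFamily.integral_abs_rpow_le_integral_gaussianReal
    {Ω ι : Type*} [MeasurableSpace Ω] {μ : Measure Ω} [IsProbabilityMeasure μ] {ε : ι → Ω → ℝ}
    (hε : IsBernoulliFamily μ ε) (a : ι → ℝ) (s : Finset ι) {p : ℝ} (hp : 3 < p) :
    ∫ ω, |bernoulliSum a ε s ω| ^ p ∂μ
      ≤ ∫ y, |y| ^ p ∂gaussianReal 0 (∑ i ∈ s, ‖a i‖₊ ^ 2) := by
  have hp0 : 0 < p := by linarith
  simpa only [zero_add] using hε.integral_const_add_bernoulliSum_le_integral_gaussianReal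
    (continuous_abs.rpow_const fun _ => Or.inr hp0.le) (convexOn_abs_rpow_comp_sqrt hp)
    (integrable_abs_rpow_gaussianReal hp0) a s 0

/-! ### Products of cosines -/

section

theorem antitoneOn_cos_mul_exp_sq_div_two :
    AntitoneOn (fun x => Real.cos x * Real.exp (x ^ 2 / 2)) (Set.Icc 0 (Real.pi / 2)) := by
  have hderiv (x : ℝ) : HasDerivAt (fun x => Real.cos x * Real.exp (x ^ 2 / 2))
      (Real.exp (x ^ 2 / 2) * (x * Real.cos x - Real.sin x)) x := by
    refine ((Real.hasDerivAt_cos x).mul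
      (((hasDerivAt_pow 2 x).div_const 2).exp)).congr_deriv ?_
    push_cast
    ring
  refine antitoneOn_of_deriv_nonpos (convex_Icc _ _)
    (fun x _ => (hderiv x).continuousAt.continuousWithinAt)
    (fun x _ => (hderiv x).differentiableAt.differentiableWithinAt) fun x hx => ?_
  rw [interior_Icc] at hx
  have hcos : 0 < Real.cos x := Real.cos_pos_of_mem_Ioo ⟨by linarith [hx.1, Real.pi_pos], hx.2⟩
  have htan := Real.lt_tan hx.1 hx.2
  rw [Real.tan_eq_sin_div_cos, lt_div_iff₀ hcos] at htan
  rw [(hderiv x).deriv]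
  exact mul_nonpos_of_nonneg_of_nonpos (Real.exp_pos _).le (by linarith)

variable {x y : ℝ}

theorem cos_le_exp_neg_sq_div_two (hx : |x| ≤ Real.pi / 2) :
    Real.cos x ≤ Real.exp (-(x ^ 2 / 2)) := by
  have h := antitoneOn_cos_mul_exp_sq_div_two ⟨le_rfl, by positivity⟩ ⟨abs_nonneg x, hx⟩
    (abs_nonneg x)
  rw [Real.exp_neg, ← one_div, le_div_iff₀ (Real.exp_pos _)]
  simpa using h

theorem cos_mul_one_sub_cos_le (hx : |x| ≤ Real.pi / 2) :
    Real.cos x * (1 - Real.cos x) ≤ 1 - Real.exp (-(x ^ 2 / 2)) := by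
  have hexp : Real.exp (-(x ^ 2 / 2)) * (1 + x ^ 2 / 2) ≤ 1 := by
    rw [Real.exp_neg, inv_mul_le_iff₀ (Real.exp_pos _)]
    linarith [Real.add_one_le_exp (x ^ 2 / 2)]
  calc Real.cos x * (1 - Real.cos x)
    _ ≤ Real.exp (-(x ^ 2 / 2)) * (x ^ 2 / 2) :=
      mul_le_mul (cos_le_exp_neg_sq_div_two hx)
        (by linarith [Real.one_sub_sq_div_two_le_cos (x := x)])
        (by linarith [Real.cos_le_one x]) (Real.exp_pos _).le
    _ ≤ 1 - Real.exp (-(x ^ 2 / 2)) := by linarith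

variable {ι : Type*} {s : Finset ι} {x : ι → ℝ}

theorem abs_prod_cos_le_one (s : Finset ι) (x : ι → ℝ) : |∏ i ∈ s, Real.cos (x i)| ≤ 1 := by
  rw [Finset.abs_prod]
  exact Finset.prod_le_one (fun _ _ => abs_nonneg _) fun _ _ => Real.abs_cos_le_one _

theorem exp_neg_sum_sq_div_two_le_one (s : Finset ι) (x : ι → ℝ) :
    Real.exp (-((∑ i ∈ s, x i ^ 2) / 2)) ≤ 1 :=
  Real.exp_le_one_iff.2 (neg_nonpos.2 (by positivity))

theorem prod_cos_le_exp_neg_sum_sq_div_two (hx : ∀ i ∈ s, |x i| ≤ Real.pi / 2) :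
    ∏ i ∈ s, Real.cos (x i) ≤ Real.exp (-((∑ i ∈ s, x i ^ 2) / 2)) := by
  rw [Finset.sum_div, ← Finset.sum_neg_distrib, Real.exp_sum]
  exact Finset.prod_le_prod (fun i hi => Real.cos_nonneg_of_mem_Icc (abs_le.1 (hx i hi)))
    fun i hi => cos_le_exp_neg_sq_div_two (hx i hi)

theorem exp_sub_cos_mul_prod_cos_le (hy : y ≤ Real.pi / 2) (hx : ∀ i ∈ s, |x i| ≤ y) :
    Real.exp (-((∑ i ∈ s, x i ^ 2) / 2)) - Real.cos y * ∏ i ∈ s, Real.cos (x i)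
      ≤ 1 - Real.cos y := by
  classical
  induction s using Finset.induction_on with
  | empty => simp
  | insert i s hi ih =>
    simp only [Finset.mem_insert, forall_eq_or_imp] at hx
    have hxi : |x i| ≤ Real.pi / 2 := hx.1.trans hy
    have hP := (abs_le.1 (abs_prod_cos_le_one s x)).2
    have hc : 0 ≤ Real.cos y := Real.cos_nonneg_of_mem_Icc ⟨by linarith [abs_nonneg (x i)], hy⟩
    have hcw : Real.cos y ≤ Real.cos (x i) := by
      rw [← Real.cos_abs (x i)]
      exact Real.cos_le_cos_of_nonneg_of_le_pi (abs_nonneg _) (by linarith [Real.pi_pos]) hx.1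
    have hwe := cos_le_exp_neg_sq_div_two hxi
    have hstep := cos_mul_one_sub_cos_le hxi
    have hw1 := Real.cos_le_one (x i)
    rw [Finset.sum_insert hi, Finset.prod_insert hi, add_div, neg_add, Real.exp_add]
    set E := Real.exp (-((∑ i ∈ s, x i ^ 2) / 2))
    set P := ∏ i ∈ s, Real.cos (x i)
    set e := Real.exp (-(x i ^ 2 / 2))
    set w := Real.cos (x i)
    set c := Real.cos y
    calc e * E - c * (w * P)
      _ = e * (E - c * P) + c * (e - w) * P := by ring
      _ ≤ e * (1 - c) + c * (e - w) :=
        add_le_add (mul_le_mul_of_nonneg_left (ih hx.2) (Real.exp_pos _).le)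
          (mul_le_of_le_one_right (mul_nonneg hc (by linarith)) hP)
      _ = e + c * (1 - w) - c := by ring
      _ ≤ e + w * (1 - w) - c := by gcongr
      _ ≤ 1 - c := by linarith

theorem exp_le_cos_mul_prod_cos_add (hy : 0 ≤ y) (hx : ∀ i ∈ s, |x i| ≤ y) :
    Real.exp (-((∑ i ∈ s, x i ^ 2) / 2)) ≤ Real.cos y * ∏ i ∈ s, Real.cos (x i) + y ^ 2 / 2 := by
  have hcos := Real.one_sub_sq_div_two_le_cos (x := y)
  have hE := exp_neg_sum_sq_div_two_le_one s x
  have hP := abs_prod_cos_le_one s x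
  rcases le_or_gt y (Real.pi / 2) with hy1 | hy1
  · linarith [exp_sub_cos_mul_prod_cos_le hy1 hx]
  rcases le_or_gt y Real.pi with hy2 | hy2
  · have hc : Real.cos y ≤ 0 := Real.cos_nonpos_of_pi_div_two_le_of_le hy1.le (by linarith)
    nlinarith [(abs_le.1 hP).2]
  · have hcP : |Real.cos y * ∏ i ∈ s, Real.cos (x i)| ≤ 1 := by
      rw [abs_mul]
      exact mul_le_one₀ (Real.abs_cos_le_one y) (abs_nonneg _) hP
    nlinarith [(abs_le.1 hcP).1, Real.pi_gt_three]

theorem prod_cos_le_exp_add (hx : ∀ i ∈ s, |x i| ≤ y) :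
    ∏ i ∈ s, Real.cos (x i) ≤ Real.exp (-((∑ i ∈ s, x i ^ 2 + y ^ 2) / 2)) + y ^ 2 / 2 := by
  rw [add_div, neg_add, Real.exp_add]
  have hP := (abs_le.1 (abs_prod_cos_le_one s x)).2
  rcases le_or_gt (y ^ 2 / 2) 1 with hy | hy
  · have hy1 : y ≤ Real.pi / 2 := by nlinarith [Real.pi_gt_three]
    have h := prod_cos_le_exp_neg_sum_sq_div_two fun i hi => (hx i hi).trans hy1
    have hE := exp_neg_sum_sq_div_two_le_one s x
    set E := Real.exp (-((∑ i ∈ s, x i ^ 2) / 2))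
    calc ∏ i ∈ s, Real.cos (x i)
      _ ≤ E * (1 - y ^ 2 / 2) + E * (y ^ 2 / 2) := by linarith
      _ ≤ E * Real.exp (-(y ^ 2 / 2)) + 1 * (y ^ 2 / 2) := by
        gcongr
        exact Real.one_sub_le_exp_neg _
    linarith
  · have : 0 < Real.exp (-((∑ i ∈ s, x i ^ 2) / 2)) * Real.exp (-(y ^ 2 / 2)) := by positivity
    linarith

end

/-! ### Moments of order between two and four -/

section

/-- The remainder `cos u - (1 - u ^ 2 / 2)`. For `2 < p < 4`, integrating `cosRemainder (t * x)`
against `t ^ (-p - 1)` over `t > 0` reproduces `|x| ^ p` up to a positive constant. -/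
noncomputable def cosRemainder (u : ℝ) : ℝ := Real.cos u - 1 + u ^ 2 / 2

/-- The constant `∫ t in (0, ∞), cosRemainder t * t ^ (-p - 1)` of the integral representation of
`|x| ^ p`, meant for `2 < p < 4`, where the integral converges. -/
noncomputable def cosMoment (p : ℝ) : ℝ := ∫ t in Set.Ioi 0, cosRemainder t * t ^ (-p - 1)

theorem continuous_cosRemainder : Continuous cosRemainder := by
  unfold cosRemainder
  fun_prop

theorem cosRemainder_nonneg (u : ℝ) : 0 ≤ cosRemainder u := by
  unfold cosRemainder
  linarith [Real.one_sub_sq_div_two_le_cos (x := u)]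

theorem cosRemainder_neg (u : ℝ) : cosRemainder (-u) = cosRemainder u := by
  simp [cosRemainder]

theorem cosRemainder_le_sq (u : ℝ) : cosRemainder u ≤ u ^ 2 := by
  unfold cosRemainder
  linarith [Real.cos_le_one u, sq_nonneg u]

theorem cosRemainder_le_pow_four {u : ℝ} (hu : |u| ≤ 1) : cosRemainder u ≤ u ^ 4 := by
  have h := (abs_le.1 (Real.cos_bound hu)).2
  rw [Even.pow_abs (by decide)] at h
  unfold cosRemainder
  linarith [show 0 ≤ u ^ 4 by positivity]

theorem cosRemainder_pos {u : ℝ} (hu : 2 < u) : 0 < cosRemainder u := by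
  unfold cosRemainder
  nlinarith [Real.neg_one_le_cos u]

variable {p : ℝ}

theorem cosRemainder_mul_rpow_nonneg (u : ℝ) {t : ℝ} (ht : 0 ≤ t) :
    0 ≤ cosRemainder u * t ^ p :=
  mul_nonneg (cosRemainder_nonneg u) (Real.rpow_nonneg ht _)

theorem integrableOn_cosRemainder_mul_rpow (hp : 2 < p) (hp4 : p < 4) :
    IntegrableOn (fun t => cosRemainder t * t ^ (-p - 1)) (Set.Ioi 0) := by
  have hmeas : Measurable fun t : ℝ => cosRemainder t * t ^ (-p - 1) :=
    continuous_cosRemainder.measurable.mul (by fun_prop)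
  rw [← Set.Ioc_union_Ioi_eq_Ioi zero_le_one]
  refine IntegrableOn.union ?near_zero ?at_top
  case near_zero =>
    have h : IntegrableOn (fun t : ℝ => t ^ (3 - p)) (Set.Ioc 0 1) :=
      (intervalIntegrable_iff_integrableOn_Ioc_of_le zero_le_one).1
        (intervalIntegral.intervalIntegrable_rpow' (by linarith))
    refine Integrable.mono' h hmeas.aestronglyMeasurable ?_
    filter_upwards [ae_restrict_mem measurableSet_Ioc] with t ht
    rw [Real.norm_of_nonneg (cosRemainder_mul_rpow_nonneg t ht.1.le),
      show 3 - p = (4 : ℕ) + (-p - 1) by push_cast; ring, Real.rpow_add ht.1, Real.rpow_natCast]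
    gcongr
    · exact Real.rpow_nonneg ht.1.le _
    · exact cosRemainder_le_pow_four ((abs_of_pos ht.1).trans_le ht.2)
  case at_top =>
    have h : IntegrableOn (fun t : ℝ => t ^ (1 - p)) (Set.Ioi 1) :=
      integrableOn_Ioi_rpow_of_lt (by linarith) one_pos
    refine Integrable.mono' h hmeas.aestronglyMeasurable ?_
    filter_upwards [ae_restrict_mem measurableSet_Ioi] with t ht
    have ht0 : 0 < t := one_pos.trans ht
    rw [Real.norm_of_nonneg (cosRemainder_mul_rpow_nonneg t ht0.le),
      show 1 - p = (2 : ℕ) + (-p - 1) by push_cast; ring, Real.rpow_add ht0, Real.rpow_natCast]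
    gcongr
    exact cosRemainder_le_sq t

theorem cosMoment_pos (hp : 2 < p) (hp4 : p < 4) : 0 < cosMoment p := by
  rw [cosMoment, setIntegral_pos_iff_support_of_nonneg_ae _
    (integrableOn_cosRemainder_mul_rpow hp hp4)]
  · have hsub : Set.Ioi (2 : ℝ) ⊆
        Function.support (fun t => cosRemainder t * t ^ (-p - 1)) ∩ Set.Ioi 0 := fun t ht =>
      have ht0 : 0 < t := two_pos.trans ht
      ⟨(mul_pos (cosRemainder_pos ht) (Real.rpow_pos_of_pos ht0 _)).ne', ht0⟩
    exact lt_of_lt_of_le (by simp) (measure_mono hsub)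
  · filter_upwards [ae_restrict_mem measurableSet_Ioi] with t ht
    exact cosRemainder_mul_rpow_nonneg t (le_of_lt ht)

theorem cosRemainder_mul_mul_rpow {x t : ℝ} (hx : 0 < x) (ht : 0 < t) :
    cosRemainder (t * x) * t ^ (-p - 1)
      = x ^ (p + 1) * (cosRemainder (x * t) * (x * t) ^ (-p - 1)) := by
  have hx1 : x ^ (p + 1) * x ^ (-p - 1) = 1 := by
    rw [← Real.rpow_add hx, show p + 1 + (-p - 1) = 0 by ring, Real.rpow_zero]
  rw [Real.mul_rpow hx.le ht.le, mul_comm t x]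
  linear_combination (-cosRemainder (x * t) * t ^ (-p - 1)) * hx1

theorem integrableOn_cosRemainder_mul_mul_rpow (hp : 2 < p) (hp4 : p < 4) (x : ℝ) :
    IntegrableOn (fun t => cosRemainder (t * x) * t ^ (-p - 1)) (Set.Ioi 0) := by
  wlog hx : 0 < x generalizing x
  · rcases eq_or_lt_of_le (not_lt.1 hx) with rfl | hx
    · simp [cosRemainder]
    · simpa [cosRemainder_neg] using this (-x) (by linarith)
  have h := (integrableOn_Ioi_comp_mul_left_iff
    (fun t => cosRemainder t * t ^ (-p - 1)) 0 hx).2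
    (by simpa using integrableOn_cosRemainder_mul_rpow hp hp4)
  exact IntegrableOn.congr_fun (h.const_mul (x ^ (p + 1)))
    (fun t ht => (cosRemainder_mul_mul_rpow hx ht).symm) measurableSet_Ioi

theorem integral_cosRemainder_mul_mul_rpow (hp : p ≠ 0) (x : ℝ) :
    ∫ t in Set.Ioi 0, cosRemainder (t * x) * t ^ (-p - 1) = |x| ^ p * cosMoment p := by
  wlog hx : 0 < x generalizing x
  · rcases eq_or_lt_of_le (not_lt.1 hx) with rfl | hx
    · simp [cosRemainder, Real.zero_rpow hp]
    · simpa [cosRemainder_neg] using this (-x) (by linarith)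
  rw [setIntegral_congr_fun measurableSet_Ioi fun t ht => cosRemainder_mul_mul_rpow hx ht,
    integral_const_mul, integral_comp_mul_left_Ioi
      (fun t => cosRemainder t * t ^ (-p - 1)) 0 hx, mul_zero, ← cosMoment,
    abs_of_pos hx, smul_eq_mul, ← mul_assoc, Real.rpow_add hx, Real.rpow_one,
    mul_inv_cancel_right₀ hx.ne']

variable {Ω Ω' : Type*} [MeasurableSpace Ω] [MeasurableSpace Ω'] {μ : Measure Ω} {ν : Measure Ω'}
  {X : Ω → ℝ} {Y : Ω' → ℝ}

theorem integral_cosRemainder_mul_of_memLp [IsProbabilityMeasure μ] (hX : MemLp X 2 μ) (t : ℝ) :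
    ∫ ω, cosRemainder (t * X ω) ∂μ
      = ∫ ω, Real.cos (t * X ω) ∂μ - 1 + t ^ 2 * (∫ ω, X ω ^ 2 ∂μ) / 2 := by
  have hcos : Integrable (fun ω => Real.cos (t * X ω)) μ :=
    Integrable.of_bound (hX.1.const_mul t |> Real.continuous_cos.comp_aestronglyMeasurable) 1
      (Filter.Eventually.of_forall fun ω => Real.abs_cos_le_one _)
  have hsq : Integrable (fun ω => (t * X ω) ^ 2 / 2) μ := by
    simpa only [mul_pow] using (hX.integrable_sq.const_mul (t ^ 2)).div_const 2
  unfold cosRemainder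
  have hcos1 : Integrable (fun ω => Real.cos (t * X ω) - 1) μ := hcos.sub (integrable_const 1)
  rw [integral_add hcos1 hsq, integral_sub hcos (integrable_const 1)]
  simp [mul_pow, integral_div, integral_const_mul]

theorem integrable_prod_cosRemainder (hp : 2 < p) (hp4 : p < 4) (hX : Measurable X)
    (hXp : Integrable (fun ω => |X ω| ^ p) μ) :
    Integrable (Function.uncurry fun ω t => cosRemainder (t * X ω) * t ^ (-p - 1))
      (μ.prod (volume.restrict (Set.Ioi 0))) := by
  have hmeas : Measurable (Function.uncurry fun ω t => cosRemainder (t * X ω) * t ^ (-p - 1)) :=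
    (continuous_cosRemainder.measurable.comp
      (measurable_snd.mul (hX.comp measurable_fst))).mul (measurable_snd.pow_const _)
  refine (integrable_prod_iff hmeas.aestronglyMeasurable).2
    ⟨Filter.Eventually.of_forall fun ω => integrableOn_cosRemainder_mul_mul_rpow hp hp4 (X ω),
      (hXp.mul_const (cosMoment p)).congr (Filter.Eventually.of_forall fun ω => ?_)⟩
  simp only [Function.uncurry]
  rw [← integral_cosRemainder_mul_mul_rpow (by linarith)]
  exact setIntegral_congr_fun measurableSet_Ioi fun t ht =>
    (Real.norm_of_nonneg (cosRemainder_mul_rpow_nonneg _ (le_of_lt ht))).symm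

variable [SFinite μ] [SFinite ν]

theorem integrableOn_integral_cosRemainder_mul_rpow (hp : 2 < p) (hp4 : p < 4) (hX : Measurable X)
    (hXp : Integrable (fun ω => |X ω| ^ p) μ) :
    IntegrableOn (fun t => (∫ ω, cosRemainder (t * X ω) ∂μ) * t ^ (-p - 1)) (Set.Ioi 0) := by
  simpa only [IntegrableOn, Function.uncurry, integral_mul_const] using
    (integrable_prod_cosRemainder hp hp4 hX hXp).integral_prod_right

theorem integral_abs_rpow_mul_cosMoment (hp : 2 < p) (hp4 : p < 4) (hX : Measurable X)
    (hXp : Integrable (fun ω => |X ω| ^ p) μ) :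
    (∫ ω, |X ω| ^ p ∂μ) * cosMoment p
      = ∫ t in Set.Ioi 0, (∫ ω, cosRemainder (t * X ω) ∂μ) * t ^ (-p - 1) := by
  simp only [← integral_mul_const, ← integral_cosRemainder_mul_mul_rpow (show p ≠ 0 by linarith)]
  exact integral_integral_swap (integrable_prod_cosRemainder hp hp4 hX hXp)

theorem integral_abs_rpow_le_of_integral_cosRemainder_le (hp : 2 < p) (hp4 : p < 4)
    (hX : Measurable X) (hXp : Integrable (fun ω => |X ω| ^ p) μ)
    (hY : Measurable Y) (hYp : Integrable (fun ω => |Y ω| ^ p) ν)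
    (h : ∀ t, 0 < t → ∫ ω, cosRemainder (t * X ω) ∂μ ≤ ∫ ω, cosRemainder (t * Y ω) ∂ν) :
    ∫ ω, |X ω| ^ p ∂μ ≤ ∫ ω, |Y ω| ^ p ∂ν := by
  refine le_of_mul_le_mul_right ?_ (cosMoment_pos hp hp4)
  rw [integral_abs_rpow_mul_cosMoment hp hp4 hX hXp, integral_abs_rpow_mul_cosMoment hp hp4 hY hYp]
  exact setIntegral_mono_on (integrableOn_integral_cosRemainder_mul_rpow hp hp4 hX hXp)
    (integrableOn_integral_cosRemainder_mul_rpow hp hp4 hY hYp) measurableSet_Ioi fun t ht =>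
    mul_le_mul_of_nonneg_right (h t ht) (Real.rpow_nonneg (le_of_lt ht) _)

theorem integral_cosRemainder_mul_gaussianReal (v : ℝ≥0) (t : ℝ) :
    ∫ y, cosRemainder (t * y) ∂gaussianReal 0 v
      = Real.exp (-(t ^ 2 * v) / 2) - 1 + t ^ 2 * v / 2 := by
  rw [integral_cosRemainder_mul_of_memLp (X := fun y => y) (memLp_id_gaussianReal' 2 (by simp)),
    integral_cos_mul_gaussianReal, integral_sq_gaussianReal]

end

namespace IsBernoulliFamily

variable {Ω ι : Type*} [MeasurableSpace Ω] {μ : Measure Ω} [IsProbabilityMeasure μ]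
  {ε : ι → Ω → ℝ} {s : Finset ι} {p : ℝ} {j : ι}

theorem integral_cosRemainder_mul (hε : IsBernoulliFamily μ ε) (a : ι → ℝ) (s : Finset ι) (t : ℝ) :
    ∫ ω, cosRemainder (t * bernoulliSum a ε s ω) ∂μ
      = ∏ i ∈ s, Real.cos (t * a i) - 1 + t ^ 2 * (∑ i ∈ s, a i ^ 2) / 2 := by
  rw [integral_cosRemainder_mul_of_memLp (hε.memLp_bernoulliSum a s 2), hε.integral_cos_mul,
    hε.integral_sq]

theorem integrable_abs_rpow_bernoulliSum (hε : IsBernoulliFamily μ ε) (a : ι → ℝ) (s : Finset ι)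
    (hp : 0 ≤ p) : Integrable (fun ω => |bernoulliSum a ε s ω| ^ p) μ :=
  hε.integrable_comp_bernoulliSum a s (continuous_abs.rpow_const fun _ => Or.inr hp)

theorem integral_abs_rpow_gaussianReal_le_of_lt_four [DecidableEq ι] (hε : IsBernoulliFamily μ ε)
    {a : ι → ℝ} (hp : 2 < p) (hp4 : p < 4) (hj : j ∈ s) (hmax : ∀ i ∈ s, |a i| ≤ |a j|) :
    ∫ y, |y| ^ p ∂gaussianReal 0 (∑ i ∈ s.erase j, ‖a i‖₊ ^ 2)
      ≤ ∫ ω, |bernoulliSum a ε s ω| ^ p ∂μ := by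
  have hp0 : 0 < p := by linarith
  refine integral_abs_rpow_le_of_integral_cosRemainder_le hp hp4 measurable_id
    (integrable_abs_rpow_gaussianReal hp0 0 _) (hε.measurable_bernoulliSum a s)
    (hε.integrable_abs_rpow_bernoulliSum a s hp0.le) fun t _ => ?_
  have h := exp_le_cos_mul_prod_cos_add (s := s.erase j) (x := fun i => t * a i)
    (abs_nonneg (t * a j)) fun i hi => by
      simpa only [abs_mul] using
        mul_le_mul_of_nonneg_left (hmax i (Finset.mem_of_mem_erase hi)) (abs_nonneg t)
  rw [Real.cos_abs, Finset.mul_prod_erase s (fun i => Real.cos (t * a i)) hj] at h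
  simp only [mul_pow, sq_abs, ← Finset.mul_sum] at h
  simp only [integral_cosRemainder_mul_gaussianReal, hε.integral_cosRemainder_mul,
    NNReal.coe_sum, NNReal.coe_pow, coe_nnnorm, Real.norm_eq_abs, sq_abs]
  rw [← Finset.add_sum_erase s _ hj, neg_div]
  linarith

theorem integral_abs_rpow_le_integral_gaussianReal_of_lt_four (hε : IsBernoulliFamily μ ε)
    {a : ι → ℝ} (hp : 2 < p) (hp4 : p < 4) (hmax : ∀ i ∈ s, |a i| ≤ |a j|) :
    ∫ ω, |bernoulliSum a ε s ω| ^ p ∂μ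
      ≤ ∫ y, |y| ^ p ∂gaussianReal 0 (∑ i ∈ s, ‖a i‖₊ ^ 2 + ‖a j‖₊ ^ 2) := by
  have hp0 : 0 < p := by linarith
  refine integral_abs_rpow_le_of_integral_cosRemainder_le hp hp4 (hε.measurable_bernoulliSum a s)
    (hε.integrable_abs_rpow_bernoulliSum a s hp0.le) measurable_id
    (integrable_abs_rpow_gaussianReal hp0 0 _) fun t _ => ?_
  have h := prod_cos_le_exp_add (s := s) (x := fun i => t * a i) (y := |t * a j|) fun i hi => by
      simpa only [abs_mul] using mul_le_mul_of_nonneg_left (hmax i hi) (abs_nonneg t)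
  simp only [mul_pow, sq_abs, ← Finset.mul_sum, ← mul_add] at h
  simp only [integral_cosRemainder_mul_gaussianReal, hε.integral_cosRemainder_mul,
    NNReal.coe_add, NNReal.coe_sum, NNReal.coe_pow, coe_nnnorm, Real.norm_eq_abs, sq_abs]
  rw [neg_div]
  linarith

end IsBernoulliFamily

/-! ### Norm bounds -/

theorem integral_abs_rpow_gaussianReal_eq_rpow {p : ℝ} (hp : 0 < p) (v : ℝ≥0) :
    ∫ y, |y| ^ p ∂gaussianReal 0 v = (gaussianNorm p * √v) ^ p := by
  rw [← lpNorm_id_gaussianReal, lpNorm_rpow_eq_integral_abs_rpow (by fun_prop) hp]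

theorem integral_abs_rpow_gaussianReal_mono {p : ℝ} (hp : 0 < p) :
    Monotone fun v => ∫ y, |y| ^ p ∂gaussianReal 0 v := fun v w hvw => by
  simp only [integral_abs_rpow_gaussianReal_eq_rpow hp]
  have hγ := gaussianNorm_nonneg p
  gcongr

theorem one_div_sqrt_two_mul_rpow_le {p x : ℝ} {n : ℕ} (hn : n ≤ p / 2) (hx : 0 ≤ x) :
    (1 / √2 * x) ^ p ≤ x ^ p / 2 ^ n := by
  have hsqrt : √2 ^ p = 2 ^ (p / 2) := by
    rw [Real.sqrt_eq_rpow, ← Real.rpow_mul zero_le_two, one_div_mul_eq_div]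
  rw [one_div_mul_eq_div, Real.div_rpow hx (Real.sqrt_nonneg 2), hsqrt, ← Real.rpow_natCast 2]
  gcongr
  exact one_le_two

theorem fourth_moment_bound_le {τ b : ℝ} (hτ : 0 ≤ τ) (hτb : τ ≤ 2 * b) :
    3 * τ ^ 4 + 6 * b ^ 2 * τ ^ 2 + b ^ 4 ≤ (τ + b) ^ 4 := by
  have hdiff : 0 ≤ τ ^ 3 * (2 * b - τ) := mul_nonneg (by positivity) (by linarith)
  have hcross : 0 ≤ b ^ 3 * τ := mul_nonneg (pow_nonneg (by linarith) 3) hτ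
  nlinarith

theorem mul_sqrt_add_two_mul_sq_le {γ τ b : ℝ} (hγ : 0 ≤ γ) (hγ2 : γ ≤ 2) (hb : 0 ≤ b)
    (hbτ : 2 * b ≤ τ) : γ * √(τ ^ 2 + 2 * b ^ 2) ≤ γ * τ + b := by
  have hτ : 0 ≤ τ := by linarith
  have hcross : 0 ≤ γ * b * (τ - 2 * b) := mul_nonneg (by positivity) (by linarith)
  have hsq : 0 ≤ (2 - γ) * γ * b ^ 2 :=
    mul_nonneg (mul_nonneg (by linarith) hγ) (sq_nonneg b)
  refine le_of_sq_le_sq ?_ (by positivity)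
  rw [mul_pow, Real.sq_sqrt (by positivity)]
  nlinarith

namespace IsBernoulliFamily

variable {Ω ι : Type*} [MeasurableSpace Ω] {μ : Measure Ω} [IsProbabilityMeasure μ]
  {ε : ι → Ω → ℝ} {a : ι → ℝ} {s t : Finset ι} {p : ℝ} {j : ι}

theorem sub_one_mul_sum_sq_mul_integral_abs_rpow_le [DecidableEq ι] (hε : IsBernoulliFamily μ ε)
    (a : ι → ℝ) (s : Finset ι) (hp : 3 < p) :
    (p - 1) * ∑ i ∈ s, a i ^ 2 * ∫ ω, |bernoulliSum a ε (s.erase i) ω| ^ (p - 2) ∂μ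
      ≤ ∫ ω, |bernoulliSum a ε s ω| ^ p ∂μ := by
  set f : ℝ → ℝ := fun x => |x| ^ (p - 2) * x
  have hf (x : ℝ) : HasDerivAt f ((p - 1) * |x| ^ (p - 2)) x :=
    (hasDerivAt_abs_rpow_mul_self (by linarith) x).congr_deriv (by ring)
  have hf' : ConvexOn ℝ Set.univ fun x : ℝ => (p - 1) * |x| ^ (p - 2) :=
    (convexOn_abs_rpow (by linarith)).smul (by linarith)
  have hcont : Continuous f := continuous_iff_continuousAt.2 fun x => (hf x).continuousAt
  have hpow (x : ℝ) : |x| ^ p = x * f x := by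
    rw [mul_left_comm, ← sq, ← sq_abs, ← Real.rpow_two,
      ← Real.rpow_add_of_nonneg (abs_nonneg x) (by linarith) zero_le_two, sub_add_cancel]
  simp only [hpow]
  rw [hε.integral_bernoulliSum_mul_comp a s hcont, Finset.mul_sum]
  refine Finset.sum_le_sum fun i _ => ?_
  rw [← mul_assoc, ← integral_const_mul, ← integral_const_mul]
  refine integral_mono ((hε.integrable_abs_rpow_bernoulliSum a _ (by linarith)).const_mul _)
    (hε.integrable_comp_bernoulliSum a (s.erase i)
      (f := fun x => a i * ((f (x + a i) - f (x - a i)) / 2)) (by fun_prop)) fun ω => ?_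
  have h := two_mul_sq_mul_deriv_le_of_convexOn hf hf' (bernoulliSum a ε (s.erase i) ω) (a i)
  simp only
  linarith

theorem integral_abs_rpow_gaussianReal_le_of_forall_erase [DecidableEq ι]
    (hε : IsBernoulliFamily μ ε) (hp : 3 < p) {v : ℝ≥0} (hv : v ≤ ∑ i ∈ s, a i ^ 2)
    (h : ∀ i ∈ s, ∫ y, |y| ^ (p - 2) ∂gaussianReal 0 v
      ≤ ∫ ω, |bernoulliSum a ε (s.erase i) ω| ^ (p - 2) ∂μ) :
    ∫ y, |y| ^ p ∂gaussianReal 0 v ≤ ∫ ω, |bernoulliSum a ε s ω| ^ p ∂μ := by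
  have hp1 : 0 ≤ p - 1 := by linarith
  have : 0 ≤ ∫ y, |y| ^ (p - 2) ∂gaussianReal 0 v :=
    integral_nonneg fun y => by positivity
  calc ∫ y, |y| ^ p ∂gaussianReal 0 v
    _ = (p - 1) * (v * ∫ y, |y| ^ (p - 2) ∂gaussianReal 0 v) := by
      rw [integral_abs_rpow_gaussianReal_eq_mul (by linarith), mul_assoc]
    _ ≤ (p - 1) * ((∑ i ∈ s, a i ^ 2) * ∫ y, |y| ^ (p - 2) ∂gaussianReal 0 v) := by gcongr
    _ ≤ (p - 1) * ∑ i ∈ s, a i ^ 2 * ∫ ω, |bernoulliSum a ε (s.erase i) ω| ^ (p - 2) ∂μ := by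
      rw [Finset.sum_mul]
      gcongr with i hi
      exact h i hi
    _ ≤ ∫ ω, |bernoulliSum a ε s ω| ^ p ∂μ :=
      hε.sub_one_mul_sum_sq_mul_integral_abs_rpow_le a s hp

theorem integral_abs_rpow_gaussianReal_le [DecidableEq ι] (hε : IsBernoulliFamily μ ε)
    (hp : 2 ≤ p) {v : ℝ≥0}
    (h : ∀ t ⊆ s, (t.card : ℝ) < p / 2 → v ≤ ∑ i ∈ s \ t, a i ^ 2) :
    ∫ y, |y| ^ p ∂gaussianReal 0 v ≤ ∫ ω, |bernoulliSum a ε s ω| ^ p ∂μ := by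
  obtain ⟨N, hN⟩ := exists_nat_gt p
  induction N generalizing p s with
  | zero => norm_num at hN; linarith
  | succ N ih =>
    have hp0 : 0 < p := by linarith
    have hv : v ≤ ∑ i ∈ s, a i ^ 2 := by
      simpa using h ∅ s.empty_subset (by simpa using hp0)
    rcases eq_or_lt_of_le hp with rfl | hp2
    · simpa only [Real.rpow_two, sq_abs, integral_sq_gaussianReal, hε.integral_sq] using hv
    rcases lt_or_ge p 4 with hp4 | hp4
    · rcases s.eq_empty_or_nonempty with rfl | hs
      · have hv0 : v = 0 := le_antisymm (by exact_mod_cast hv) zero_le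
        simp [hv0, bernoulliSum]
      obtain ⟨j, hj, hmax⟩ := s.exists_max_image (fun i => |a i|) hs
      refine (integral_abs_rpow_gaussianReal_mono hp0 ?_).trans
        (hε.integral_abs_rpow_gaussianReal_le_of_lt_four hp2 hp4 hj hmax)
      have hvj := h {j} (Finset.singleton_subset_iff.2 hj) (by simp; linarith)
      rw [Finset.sdiff_singleton_eq_erase] at hvj
      simpa [← NNReal.coe_le_coe] using hvj
    · refine hε.integral_abs_rpow_gaussianReal_le_of_forall_erase (by linarith) hv fun i hi =>
        ih (by linarith) (fun t ht hcard => ?_) (by push_cast at hN; linarith)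
      have hit : i ∉ t := fun hit => Finset.notMem_erase i s (ht hit)
      have hvi := h (insert i t) (Finset.insert_subset hi (ht.trans (Finset.erase_subset i s)))
        (by rw [Finset.card_insert_of_notMem hit]; push_cast; linarith)
      rwa [Finset.sdiff_insert, ← Finset.erase_sdiff_comm] at hvi

theorem gaussianNorm_mul_sqrt_le_lpNorm [DecidableEq ι] (hε : IsBernoulliFamily μ ε)
    (hp : 2 ≤ p) {v : ℝ} (hv : 0 ≤ v)
    (h : ∀ t ⊆ s, (t.card : ℝ) < p / 2 → v ≤ ∑ i ∈ s \ t, a i ^ 2) :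
    gaussianNorm p * √v ≤ lpNorm (bernoulliSum a ε s) (ENNReal.ofReal p) μ := by
  lift v to ℝ≥0 using hv
  rw [← lpNorm_id_gaussianReal]
  exact lpNorm_le_lpNorm_of_integral_abs_rpow_le (by fun_prop) (hε.memLp_bernoulliSum a s 0).1
    (by linarith) (hε.integral_abs_rpow_gaussianReal_le hp h)

theorem one_div_sqrt_two_mul_sum_abs_le_lpNorm (hε : IsBernoulliFamily μ ε) (a : ι → ℝ)
    (hp : 1 ≤ p) (hts : t ⊆ s) (ht : t.card ≤ p / 2) :
    1 / √2 * ∑ i ∈ t, |a i| ≤ lpNorm (bernoulliSum a ε s) (ENNReal.ofReal p) μ := by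
  have hp0 : 0 < p := by linarith
  have hsum : 0 ≤ ∑ i ∈ t, |a i| := Finset.sum_nonneg fun i _ => abs_nonneg (a i)
  rw [← Real.rpow_le_rpow_iff (by positivity) lpNorm_nonneg hp0,
    lpNorm_rpow_eq_integral_abs_rpow (hε.memLp_bernoulliSum a s 0).1 hp0]
  calc (1 / √2 * ∑ i ∈ t, |a i|) ^ p
    _ ≤ |(∑ i ∈ t, |a i|)| ^ p / 2 ^ t.card := by
      rw [abs_of_nonneg hsum]
      exact one_div_sqrt_two_mul_rpow_le ht hsum
    _ ≤ ∫ ω, |bernoulliSum a ε t ω| ^ p ∂μ :=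
      hε.div_two_pow_card_le_integral_comp a t (f := fun x => |x| ^ p)
        (continuous_abs.rpow_const fun _ => Or.inr hp0.le) fun x => by positivity
    _ ≤ ∫ ω, |bernoulliSum a ε s ω| ^ p ∂μ :=
      hε.monotone_integral_comp a (convexOn_abs_rpow hp) hts

theorem lpNorm_le_lpNorm_sdiff_add [DecidableEq ι] (hε : IsBernoulliFamily μ ε) (a : ι → ℝ)
    (hts : t ⊆ s) {q : ℝ≥0∞} (hq : 1 ≤ q) :
    lpNorm (bernoulliSum a ε s) q μ ≤ lpNorm (bernoulliSum a ε (s \ t)) q μ + ∑ i ∈ t, |a i| := by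
  have hsplit : bernoulliSum a ε s = bernoulliSum a ε (s \ t) + bernoulliSum a ε t :=
    funext fun ω => (Finset.sum_sdiff hts).symm
  rw [hsplit]
  refine (lpNorm_add_le (hε.memLp_bernoulliSum a _ q) hq).trans ?_
  gcongr
  exact lpNorm_le_of_ae_abs_le (hε.memLp_bernoulliSum a t 0).1
    (Finset.sum_nonneg fun i _ => abs_nonneg (a i)) (hε.ae_abs_bernoulliSum_le a t)

theorem lpNorm_two (hε : IsBernoulliFamily μ ε) (a : ι → ℝ) (s : Finset ι) :
    lpNorm (bernoulliSum a ε s) (ENNReal.ofReal 2) μ = √(∑ i ∈ s, a i ^ 2) := by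
  have h := lpNorm_rpow_eq_integral_abs_rpow (hε.memLp_bernoulliSum a s 0).1 two_pos
  simp only [Real.rpow_two, sq_abs, hε.integral_sq] at h
  rw [← h, Real.sqrt_sq lpNorm_nonneg]

theorem lpNorm_le_gaussianNorm_mul_sqrt (hε : IsBernoulliFamily μ ε) (a : ι → ℝ) (s : Finset ι)
    (hp : 3 < p) :
    lpNorm (bernoulliSum a ε s) (ENNReal.ofReal p) μ ≤ gaussianNorm p * √(∑ i ∈ s, a i ^ 2) := by
  have h := lpNorm_le_lpNorm_of_integral_abs_rpow_le (Y := fun y => y)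
    (hε.memLp_bernoulliSum a s 0).1 (by fun_prop) (by linarith)
    (hε.integral_abs_rpow_le_integral_gaussianReal a s hp)
  simpa [lpNorm_id_gaussianReal] using h

theorem lpNorm_le_gaussianNorm_mul_sqrt_of_lt_four (hε : IsBernoulliFamily μ ε) (hp : 2 < p)
    (hp4 : p < 4) (hmax : ∀ i ∈ s, |a i| ≤ |a j|) :
    lpNorm (bernoulliSum a ε s) (ENNReal.ofReal p) μ
      ≤ gaussianNorm p * √(∑ i ∈ s, a i ^ 2 + a j ^ 2) := by
  have h := lpNorm_le_lpNorm_of_integral_abs_rpow_le (Y := fun y => y)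
    (hε.memLp_bernoulliSum a s 0).1 (by fun_prop) (by linarith)
    (hε.integral_abs_rpow_le_integral_gaussianReal_of_lt_four hp hp4 hmax)
  simpa [lpNorm_id_gaussianReal] using h

theorem lpNorm_four_le_of_sqrt_le [DecidableEq ι] (hε : IsBernoulliFamily μ ε) (hj : j ∈ s)
    (hle : √(∑ i ∈ s.erase j, a i ^ 2) ≤ 2 * |a j|) :
    lpNorm (bernoulliSum a ε s) (ENNReal.ofReal 4) μ
      ≤ √(∑ i ∈ s.erase j, a i ^ 2) + |a j| := by
  have hV : 0 ≤ ∑ i ∈ s.erase j, a i ^ 2 := Finset.sum_nonneg fun i _ => sq_nonneg (a i)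
  have hfour (x : ℝ) : |x| ^ (4 : ℝ) = x ^ 4 := by
    rw [← Nat.cast_ofNat, Real.rpow_natCast, Even.pow_abs (by decide)]
  have hnorm := lpNorm_rpow_eq_integral_abs_rpow (hε.memLp_bernoulliSum a s 0).1 four_pos
  rw [← Nat.cast_ofNat, Real.rpow_natCast, Nat.cast_ofNat] at hnorm
  simp only [hfour] at hnorm
  refine le_of_pow_le_pow_left₀ four_ne_zero (by positivity) ?_
  rw [hnorm]
  refine le_trans ?_ (fourth_moment_bound_le (Real.sqrt_nonneg _) hle)
  have hstep := hε.integral_pow_four_insert a (Finset.notMem_erase j s)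
  rw [Finset.insert_erase hj] at hstep
  have hbound := hε.integral_pow_four_le a (s.erase j)
  rw [show √(∑ i ∈ s.erase j, a i ^ 2) ^ 4 = (√(∑ i ∈ s.erase j, a i ^ 2) ^ 2) ^ 2 by ring,
    Real.sq_sqrt hV, sq_abs, Even.pow_abs (by decide)]
  linarith

theorem lpNorm_le_gaussianNorm_mul_sqrt_erase_add [DecidableEq ι] (hε : IsBernoulliFamily μ ε)
    (hp : 2 < p) (hp4 : p < 4) (hj : j ∈ s) (hmax : ∀ i ∈ s, |a i| ≤ |a j|) :
    lpNorm (bernoulliSum a ε s) (ENNReal.ofReal p) μ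
      ≤ gaussianNorm p * √(∑ i ∈ s.erase j, a i ^ 2) + |a j| := by
  rcases le_total √(∑ i ∈ s.erase j, a i ^ 2) (2 * |a j|) with hle | hle
  · calc lpNorm (bernoulliSum a ε s) (ENNReal.ofReal p) μ
      _ ≤ lpNorm (bernoulliSum a ε s) (ENNReal.ofReal 4) μ :=
        lpNorm_le_lpNorm_of_exponent_le (ENNReal.ofReal_le_ofReal hp4.le)
          (hε.memLp_bernoulliSum a s _)
      _ ≤ √(∑ i ∈ s.erase j, a i ^ 2) + |a j| := hε.lpNorm_four_le_of_sqrt_le hj hle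
      _ ≤ gaussianNorm p * √(∑ i ∈ s.erase j, a i ^ 2) + |a j| := by
        gcongr
        exact le_mul_of_one_le_left (Real.sqrt_nonneg _) (one_le_gaussianNorm hp.le)
  · have hV : 0 ≤ ∑ i ∈ s.erase j, a i ^ 2 := Finset.sum_nonneg fun i _ => sq_nonneg (a i)
    refine (hε.lpNorm_le_gaussianNorm_mul_sqrt_of_lt_four hp hp4 hmax).trans ?_
    have h := mul_sqrt_add_two_mul_sq_le (gaussianNorm_nonneg p) (gaussianNorm_le_two hp4.le)
      (abs_nonneg (a j)) hle
    rwa [Real.sq_sqrt hV, sq_abs, two_mul, ← add_assoc, Finset.sum_erase_add s _ hj] at h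

theorem lpNorm_le_gaussianNorm_mul_sqrt_sdiff_add_of_lt_four [DecidableEq ι]
    (hε : IsBernoulliFamily μ ε) (hp : 2 < p) (hp4 : p < 4) (hts : t ⊆ s) (hj : j ∈ t)
    (hmax : ∀ i ∈ s, |a i| ≤ |a j|) :
    lpNorm (bernoulliSum a ε s) (ENNReal.ofReal p) μ
      ≤ gaussianNorm p * √(∑ i ∈ s \ t, a i ^ 2) + ∑ i ∈ t, |a i| := by
  have hjs : j ∈ s \ t.erase j := Finset.mem_sdiff.2 ⟨hts hj, Finset.notMem_erase j t⟩
  have herase : (s \ t.erase j).erase j = s \ t := by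
    rw [← Finset.sdiff_insert, Finset.insert_erase hj]
  calc lpNorm (bernoulliSum a ε s) (ENNReal.ofReal p) μ
    _ ≤ lpNorm (bernoulliSum a ε (s \ t.erase j)) (ENNReal.ofReal p) μ
        + ∑ i ∈ t.erase j, |a i| :=
      hε.lpNorm_le_lpNorm_sdiff_add a ((Finset.erase_subset j t).trans hts)
        (ENNReal.one_le_ofReal.2 (by linarith))
    _ ≤ gaussianNorm p * √(∑ i ∈ s \ t, a i ^ 2) + |a j| + ∑ i ∈ t.erase j, |a i| := by
      gcongr
      exact herase ▸ hε.lpNorm_le_gaussianNorm_mul_sqrt_erase_add hp hp4 hjs fun i hi =>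
        hmax i (Finset.sdiff_subset hi)
    _ = gaussianNorm p * √(∑ i ∈ s \ t, a i ^ 2) + ∑ i ∈ t, |a i| := by
      rw [add_assoc, Finset.add_sum_erase t (fun i => |a i|) hj]

theorem lpNorm_le_gaussianNorm_mul_sqrt_sdiff_add [DecidableEq ι] (hε : IsBernoulliFamily μ ε)
    (hp : 2 ≤ p) (hts : t ⊆ s) (hdom : 2 < p → ∀ i ∈ s, ∃ j ∈ t, |a i| ≤ |a j|) :
    lpNorm (bernoulliSum a ε s) (ENNReal.ofReal p) μ
      ≤ gaussianNorm p * √(∑ i ∈ s \ t, a i ^ 2) + ∑ i ∈ t, |a i| := by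
  have htri := hε.lpNorm_le_lpNorm_sdiff_add a hts (ENNReal.one_le_ofReal.2 (by linarith : 1 ≤ p))
  rcases lt_or_ge 3 p with hp3 | hp3
  · exact htri.trans (by gcongr; exact hε.lpNorm_le_gaussianNorm_mul_sqrt a _ hp3)
  rcases eq_or_lt_of_le hp with rfl | hp2
  · simpa only [hε.lpNorm_two, gaussianNorm_two, one_mul] using htri
  rcases t.eq_empty_or_nonempty with rfl | ht
  · have hs : s = ∅ := Finset.eq_empty_of_forall_notMem fun i hi => by simpa using hdom hp2 i hi
    have hzero : bernoulliSum a ε ∅ = 0 := funext fun _ => Finset.sum_empty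
    simp [hs, hzero]
  obtain ⟨j, hj, hjmax⟩ := t.exists_max_image (fun i => |a i|) ht
  exact hε.lpNorm_le_gaussianNorm_mul_sqrt_sdiff_add_of_lt_four hp2 (by linarith) hts hj
    fun i hi =>
      have ⟨i', hi', hle⟩ := hdom hp2 i hi
      hle.trans (hjmax i' hi')

end IsBernoulliFamily

/-! ### Heads and tails of antitone sequences -/

theorem sum_le_sum_of_card_le {ι M : Type*} [DecidableEq ι] [AddCommMonoid M] [LinearOrder M]
    [IsOrderedCancelAddMonoid M] {f : ι → M} {s t : Finset ι} (hcard : s.card ≤ t.card)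
    (hf : ∀ i ∈ t \ s, 0 ≤ f i) (hst : ∀ i ∈ s \ t, ∀ j ∈ t \ s, f i ≤ f j) :
    ∑ i ∈ s, f i ≤ ∑ i ∈ t, f i := by
  rw [← Finset.sum_sdiff_le_sum_sdiff]
  rcases (s \ t).eq_empty_or_nonempty with hempty | hne
  · rw [hempty, Finset.sum_empty]
    exact Finset.sum_nonneg hf
  have hcard' : (s \ t).card ≤ (t \ s).card := Finset.card_sdiff_le_card_sdiff_iff.2 hcard
  obtain ⟨j, hj, hmin⟩ := (t \ s).exists_min_image f
    (Finset.card_pos.1 ((Finset.card_pos.2 hne).trans_le hcard'))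
  calc ∑ i ∈ s \ t, f i
    _ ≤ (s \ t).card • f j := Finset.sum_le_card_nsmul _ _ _ fun i hi => hst i hi j hj
    _ ≤ (t \ s).card • f j := nsmul_le_nsmul_left (hf j hj) hcard'
    _ ≤ ∑ i ∈ t \ s, f i := Finset.card_nsmul_le_sum _ _ _ hmin

theorem card_filter_val_add_one_lt (n k : ℕ) :
    (Finset.univ.filter fun i : Fin n => i.val + 1 < k).card = min n (k - 1) := by
  simp only [← Nat.lt_sub_iff_add_lt, Fin.card_filter_val_lt]

theorem sum_filter_le_sum_sdiff_of_antitone {n k : ℕ} {M : Type*} [AddCommMonoid M] [LinearOrder M]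
    [IsOrderedCancelAddMonoid M] {f : Fin n → M} (hf : Antitone f) (h0 : ∀ i, 0 ≤ f i)
    {t : Finset (Fin n)} (ht : t.card < k) :
    ∑ i with k ≤ i.val + 1, f i ≤ ∑ i ∈ Finset.univ \ t, f i := by
  have hhead : ∑ i ∈ t, f i ≤ ∑ i with i.val + 1 < k, f i := by
    refine sum_le_sum_of_card_le ?_ (fun i _ => h0 i) fun i hi j hj => hf (Fin.le_def.2 ?_)
    · rw [card_filter_val_add_one_lt]
      exact le_min (card_finset_fin_le t) (by omega)
    · simp only [Finset.mem_sdiff, Finset.mem_filter_univ] at hi hj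
      omega
  refine le_of_add_le_add_right (a := ∑ i ∈ t, f i) ?_
  rw [Finset.sum_sdiff t.subset_univ,
    ← Finset.sum_filter_not_add_sum_filter Finset.univ fun i : Fin n => i.val + 1 < k]
  simp only [not_lt]
  gcongr

theorem card_filter_val_add_one_lt_ceil_lt {p : ℝ} (hp : 0 < p) (n : ℕ) :
    (Finset.univ.filter fun i : Fin n => i.val + 1 < ⌈p⌉₊).card < p := by
  have hceil : 0 < ⌈p⌉₊ := Nat.ceil_pos.2 hp
  rw [← Nat.lt_ceil, card_filter_val_add_one_lt]
  omega

namespace IsBernoulliFamily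

theorem comp_injective {Ω ι κ : Type*} [MeasurableSpace Ω] {μ : Measure Ω} {ε : ι → Ω → ℝ}
    (hε : IsBernoulliFamily μ ε) {g : κ → ι} (hg : g.Injective) :
    IsBernoulliFamily μ fun k => ε (g k) where
  measurable k := hε.measurable (g k)
  prob_one k := hε.prob_one (g k)
  prob_neg_one k := hε.prob_neg_one (g k)
  indep := hε.indep.precomp hg

variable {Ω : Type*} [MeasurableSpace Ω] {μ : Measure Ω} [IsProbabilityMeasure μ] {n : ℕ}
  {ε : Fin n → Ω → ℝ} {a : Fin n → ℝ} {p : ℝ}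

theorem gaussianNorm_mul_sqrt_tail_le_lpNorm (hε : IsBernoulliFamily μ ε)
    (ha : Antitone fun i => |a i|) (hp : 2 ≤ p) :
    gaussianNorm p * √(∑ i with ⌈p / 2⌉₊ ≤ i.val + 1, |a i| ^ 2)
      ≤ lpNorm (bernoulliSum a ε Finset.univ) (ENNReal.ofReal p) μ := by
  refine hε.gaussianNorm_mul_sqrt_le_lpNorm hp (by positivity) fun t _ ht => ?_
  simp only [← sq_abs (a _)]
  exact sum_filter_le_sum_sdiff_of_antitone
    (fun i j hij => pow_le_pow_left₀ (abs_nonneg (a j)) (ha hij) 2) (fun i => by positivity)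
    (Nat.lt_ceil.2 ht)

theorem one_div_sqrt_two_mul_head_le_lpNorm (hε : IsBernoulliFamily μ ε) (a : Fin n → ℝ)
    (hp : 1 ≤ p) :
    1 / √2 * ∑ i with i.val + 1 < ⌈p / 2⌉₊, |a i|
      ≤ lpNorm (bernoulliSum a ε Finset.univ) (ENNReal.ofReal p) μ :=
  hε.one_div_sqrt_two_mul_sum_abs_le_lpNorm a hp (Finset.subset_univ _)
    (card_filter_val_add_one_lt_ceil_lt (by linarith) n).le

theorem lpNorm_le_gaussianNorm_mul_sqrt_tail_add_head (hε : IsBernoulliFamily μ ε)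
    (ha : Antitone fun i => |a i|) (hp : 2 ≤ p) :
    lpNorm (bernoulliSum a ε Finset.univ) (ENNReal.ofReal p) μ
      ≤ gaussianNorm p * √(∑ i with ⌈p / 2⌉₊ ≤ i.val + 1, |a i| ^ 2)
        + ∑ i with i.val + 1 < ⌈p / 2⌉₊, |a i| := by
  have htail : Finset.univ.filter (fun i : Fin n => ⌈p / 2⌉₊ ≤ i.val + 1)
      = Finset.univ \ Finset.univ.filter fun i : Fin n => i.val + 1 < ⌈p / 2⌉₊ := by
    simp only [← Finset.filter_not, not_lt]
  simp only [htail, sq_abs]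
  refine hε.lpNorm_le_gaussianNorm_mul_sqrt_sdiff_add hp (Finset.subset_univ _) fun hp2 i _ =>
    ⟨⟨0, i.pos⟩, (Finset.mem_filter_univ _).2 (Nat.lt_ceil.2 ?_), ha (Nat.zero_le i.val)⟩
  norm_num
  linarith

end IsBernoulliFamily

theorem corollary1 {Ω : Type*} [MeasurableSpace Ω] (μ : Measure Ω) [IsProbabilityMeasure μ]
    (n : ℕ) (ε : Fin n → Ω → ℝ) (hε : IsBernoulliFamily μ ε) (a : Fin n → ℝ)
    (p : ℝ) (hp : 2 ≤ p) :
    MemLp (fun ω => ∑ i, a i * ε i ω) (ENNReal.ofReal p) μ ∧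
    max
        (gaussianNorm p *
          Real.sqrt (∑ i with ⌈p / 2⌉₊ ≤ i.val + 1, nonincRearrangement a i ^ 2))
        (1 / Real.sqrt 2 * ∑ i with i.val + 1 < ⌈p / 2⌉₊, nonincRearrangement a i)
      ≤ lpNorm (fun ω => ∑ i, a i * ε i ω) (ENNReal.ofReal p) μ ∧
    lpNorm (fun ω => ∑ i, a i * ε i ω) (ENNReal.ofReal p) μ
      ≤ gaussianNorm p *
          Real.sqrt (∑ i with ⌈p / 2⌉₊ ≤ i.val + 1, nonincRearrangement a i ^ 2) +
        ∑ i with i.val + 1 < ⌈p / 2⌉₊, nonincRearrangement a i := by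
  set σ := Tuple.sort fun j => -|a j|
  have hσ : IsBernoulliFamily μ fun i => ε (σ i) := hε.comp_injective σ.injective
  have hsum : (fun ω => ∑ i, a i * ε i ω)
      = bernoulliSum (fun i => a (σ i)) (fun i => ε (σ i)) Finset.univ :=
    funext fun ω => (Equiv.sum_comp σ fun i => a i * ε i ω).symm
  have hanti : Antitone fun i => |a (σ i)| := nonincRearrangement_antitone a
  rw [hsum]
  exact ⟨hσ.memLp_bernoulliSum _ _ _,
    max_le (hσ.gaussianNorm_mul_sqrt_tail_le_lpNorm hanti hp)
      (hσ.one_div_sqrt_two_mul_head_le_lpNorm _ (by linarith)),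
    hσ.lpNorm_le_gaussianNorm_mul_sqrt_tail_add_head hanti hp⟩
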